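/- Let $0\le k\le n$ be integers. Let $\Lambda^{n-k,k}$ be the space of constant holomorphic $n$-forms on $\mathbb{C}^n\times(\mathbb{C}^n)^*$ (complex multilinear alternating $n$-forms) of bidegree $(n-k,k)$, that is, of degree $n-k$ in the $dz_i$ and of degree $k$ in the $dw_i$, where $(z,w)$ are the standard coordinates. Let $\omega_s=\sum_{i}dz_i\wedge dw_i$ be the natural symplectic form, and let $$P\Lambda^{n-k,k}=\{\tau\in\Lambda^{n-k,k}:\ \omega_s\wedge\tau=0\}$$ be the space of primitive forms. The group $GL(n,\mathbb{C})$ acts on $P\Lambda^{n-k,k}$ by $g\cdot\tau=(g^\#)^*\tau$, where $g^\#(z,w)=(g^{-1}z,g^*w)$. Let $SM_n$ be the space of complex symmetric $(n\times n)$-matrices, let $\mathcal{P}^k(SM_n)$ be the space of $k$-homogeneous complex polynomials on $SM_n$, and let $\mathcal{M}_k\subset\mathcal{P}^k(SM_n)$ be the space spanned by the $(k\times k)$-minors $Q\mapsto\det(Q_{i_aj_b})_{a,b=1}^k$ with $i_1<\dots<i_k$ and $j_1<\dots<j_k$. For $Q\in SM_n$ let $F_Q:\mathbb{C}^n\to\mathbb{C}^n\times(\mathbb{C}^n)^*$,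 $F_Q(z)=(z,z^TQ)$, the second component being the differential of $z\mapsto\frac12 z^TQz$. Then for every $\tau\in P\Lambda^{n-k,k}$ there is a unique $P_\tau\in\mathcal{P}^k(SM_n)$ such that $$F_Q^*\tau=P_\tau(Q)\,dz_1\wedge\dots\wedge dz_n\qquad\text{for all }Q\in SM_n.$$ The map $P\Lambda^{n-k,k}\to\mathcal{P}^k(SM_n)$, $\tau\mapsto P_\tau$, is linear and injective, and its image is exactly $\mathcal{M}_k$. Moreover, $P\Lambda^{n-k,k}$ is an irreducible representation of $GL(n,\mathbb{C})$ (in particular it is non-zero). -/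

import Mathlib

open scoped Matrix

namespace PrimitiveForms

/-- The complex vector space `ℂⁿ × (ℂⁿ)*`. -/
abbrev Phase (n : ℕ) : Type := (Fin n → ℂ) × Module.Dual ℂ (Fin n → ℂ)

/-- Constant holomorphic `n`-forms on `ℂⁿ × (ℂⁿ)*`, that is, complex multilinear alternating
`n`-forms. -/
abbrev Form (n : ℕ) : Type := Phase n [⋀^Fin n]→ₗ[ℂ] ℂ

/-- The wedge product of two scalar valued alternating forms (the sum over shuffles). -/
noncomputable def wedge {M : Type*} [AddCommGroup M] [Module ℂ M] {ι κ : Type*}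
    [Fintype ι] [Fintype κ] [DecidableEq ι] [DecidableEq κ]
    (α : M [⋀^ι]→ₗ[ℂ] ℂ) (β : M [⋀^κ]→ₗ[ℂ] ℂ) : M [⋀^ι ⊕ κ]→ₗ[ℂ] ℂ :=
  (LinearMap.mul' ℂ ℂ).compAlternatingMap (α.domCoprod β)

/-- The natural symplectic form `∑ dzᵢ ∧ dwᵢ`, that is,
`((z, w), (z', w')) ↦ ⟨z, w'⟩ - ⟨z', w⟩`. -/
def symplecticForm (n : ℕ) : Phase n [⋀^Fin 2]→ₗ[ℂ] ℂ where
  toFun v := (v 1).2 (v 0).1 - (v 0).2 (v 1).1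
  map_update_add' {dec} v i x y := by
    rw [Subsingleton.elim dec (instDecidableEqFin 2)]
    fin_cases i <;> simp <;> ring
  map_update_smul' {dec} v i c x := by
    rw [Subsingleton.elim dec (instDecidableEqFin 2)]
    fin_cases i <;> simp <;> ring
  map_eq_zero_of_eq' v i j h hij := by
    fin_cases i <;> fin_cases j <;> simp_all

/-- The space `Λ^{n-k,k}` of constant `n`-forms of bidegree `(n-k, k)`: those vanishing on every
`n`-tuple which consists of `q ≠ k` vectors from `(ℂⁿ)*` and `n - q` vectors from `ℂⁿ`. -/
def bidegree (n k : ℕ) : Submodule ℂ (Form n) where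
  carrier := {τ | ∀ (S : Finset (Fin n)) (v : Fin n → Phase n), S.card ≠ k →
    (∀ i ∈ S, (v i).1 = 0) → (∀ i ∉ S, (v i).2 = 0) → τ v = 0}
  add_mem' h h' S v hS h1 h2 := by simp [h S v hS h1 h2, h' S v hS h1 h2]
  zero_mem' S v _ _ _ := by simp
  smul_mem' c τ h S v hS h1 h2 := by simp [h S v hS h1 h2]

theorem wedge_add_right {M : Type*} [AddCommGroup M] [Module ℂ M] {ι κ : Type*}
    [Fintype ι] [Fintype κ] [DecidableEq ι] [DecidableEq κ]
    (α : M [⋀^ι]→ₗ[ℂ] ℂ) (β γ : M [⋀^κ]→ₗ[ℂ] ℂ) :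
    wedge α (β + γ) = wedge α β + wedge α γ := by
  have h : α.domCoprod (β + γ) = α.domCoprod β + α.domCoprod γ := by
    simp only [← AlternatingMap.domCoprod'_apply, TensorProduct.tmul_add, map_add]
  ext v
  simp [wedge, h, -AlternatingMap.domCoprod_apply]

theorem wedge_smul_right {M : Type*} [AddCommGroup M] [Module ℂ M] {ι κ : Type*}
    [Fintype ι] [Fintype κ] [DecidableEq ι] [DecidableEq κ]
    (α : M [⋀^ι]→ₗ[ℂ] ℂ) (c : ℂ) (β : M [⋀^κ]→ₗ[ℂ] ℂ) :
    wedge α (c • β) = c • wedge α β := by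
  have h : α.domCoprod (c • β) = c • α.domCoprod β := by
    simp only [← AlternatingMap.domCoprod'_apply, TensorProduct.tmul_smul, map_smul]
  ext v
  simp [wedge, h, -AlternatingMap.domCoprod_apply]

theorem wedge_compLinearMap {M N : Type*} [AddCommGroup M] [Module ℂ M] [AddCommGroup N]
    [Module ℂ N] {ι κ : Type*} [Fintype ι] [Fintype κ] [DecidableEq ι] [DecidableEq κ]
    (α : M [⋀^ι]→ₗ[ℂ] ℂ) (β : M [⋀^κ]→ₗ[ℂ] ℂ) (f : N →ₗ[ℂ] M) :
    wedge (α.compLinearMap f) (β.compLinearMap f) = (wedge α β).compLinearMap f := by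
  ext v
  simp only [wedge, LinearMap.compAlternatingMap_apply, AlternatingMap.domCoprod_apply,
    AlternatingMap.compLinearMap_apply, sum_apply]
  congr 1
  refine Finset.sum_congr rfl fun σ _ => ?_
  induction σ using Quotient.inductionOn'
  simp [AlternatingMap.domCoprod.summand]

/-- The space `PΛ^{n-k,k}` of primitive forms: forms `τ` of bidegree `(n-k, k)` with
`ω ∧ τ = 0` for the symplectic form `ω`. -/
def primitive (n k : ℕ) : Submodule ℂ (Form n) where
  carrier := {τ | τ ∈ bidegree n k ∧ wedge (symplecticForm n) τ = 0}
  add_mem' h h' := ⟨add_mem h.1 h'.1, by rw [wedge_add_right, h.2, h'.2, add_zero]⟩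
  zero_mem' := ⟨zero_mem _, by
    simpa using wedge_smul_right (symplecticForm n) 0 (0 : Form n)⟩
  smul_mem' c τ h := ⟨Submodule.smul_mem _ c h.1, by rw [wedge_smul_right, h.2, smul_zero]⟩

/-- The linear map `g^# (z, w) = (g⁻¹ z, g^* w)` of `ℂⁿ × (ℂⁿ)*`. -/
noncomputable def sharp {n : ℕ} (g : GL (Fin n) ℂ) : Phase n →ₗ[ℂ] Phase n :=
  (Matrix.toLin' (g⁻¹ : GL (Fin n) ℂ).1).prodMap (Matrix.toLin' g.1).dualMap

theorem sharp_mul {n : ℕ} (g h : GL (Fin n) ℂ) : sharp (g * h) = sharp h ∘ₗ sharp g := by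
  refine LinearMap.ext fun x => Prod.ext ?_ (LinearMap.ext fun z => ?_)
  · simp [sharp, Matrix.mulVec_mulVec]
  · simp [sharp, Matrix.mulVec_mulVec]

theorem symplecticForm_compLinearMap_sharp {n : ℕ} (g : GL (Fin n) ℂ) :
    (symplecticForm n).compLinearMap (sharp g) = symplecticForm n := by
  ext v
  have h : ∀ z : Fin n → ℂ, g.1 *ᵥ ((g⁻¹ : GL (Fin n) ℂ).1 *ᵥ z) = z := fun z => by
    rw [Matrix.mulVec_mulVec, ← Units.val_mul, mul_inv_cancel, Units.val_one, Matrix.one_mulVec]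
  change ((v 1).2 (g.1 *ᵥ ((g⁻¹ : GL (Fin n) ℂ).1 *ᵥ (v 0).1)))
    - ((v 0).2 (g.1 *ᵥ ((g⁻¹ : GL (Fin n) ℂ).1 *ᵥ (v 1).1))) = _
  rw [h, h]
  rfl

/-- The action `g · τ = (g^#)^* τ` of `GL(n, ℂ)` on constant `n`-forms. -/
noncomputable def formRep (n : ℕ) : Representation ℂ (GL (Fin n) ℂ) (Form n) where
  toFun g :=
    { toFun := fun τ => τ.compLinearMap (sharp g)
      map_add' := fun _ _ => rfl
      map_smul' := fun _ _ => rfl }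
  map_one' := by
    refine LinearMap.ext fun τ => AlternatingMap.ext fun v => ?_
    have : sharp (1 : GL (Fin n) ℂ) = LinearMap.id := by
      refine LinearMap.ext fun x => Prod.ext ?_ (LinearMap.ext fun z => ?_) <;> simp [sharp]
    simp [this]
  map_mul' g h := by
    refine LinearMap.ext fun τ => AlternatingMap.ext fun v => ?_
    simp only [sharp_mul]
    rfl

theorem formRep_apply {n : ℕ} (g : GL (Fin n) ℂ) (τ : Form n) :
    formRep n g τ = τ.compLinearMap (sharp g) := rfl

/-- The `GL(n, ℂ)`-invariant subspace `PΛ^{n-k,k}` of the space of constant `n`-forms. -/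
def primitiveSubrep (n k : ℕ) : Subrepresentation (formRep n) where
  toSubmodule := primitive n k
  apply_mem_toSubmodule g τ h := by
    refine ⟨fun S v hS h1 h2 => h.1 S _ hS ?_ ?_, ?_⟩
    · intro i hi
      simp [sharp, h1 i hi]
    · intro i hi
      simp [sharp, h2 i hi]
    · rw [formRep_apply, ← symplecticForm_compLinearMap_sharp g, wedge_compLinearMap, h.2]
      rfl

/-- `PΛ^{n-k,k}` as a representation of `GL(n, ℂ)`. -/
noncomputable def primitiveRep (n k : ℕ) : Representation ℂ (GL (Fin n) ℂ) (primitive n k) :=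
  (primitiveSubrep n k).toRepresentation

/-- The space of complex symmetric `n × n` matrices. -/
def SM (n : ℕ) : Submodule ℂ (Matrix (Fin n) (Fin n) ℂ) where
  carrier := {A | A.IsSymm}
  add_mem' h h' := h.add h'
  zero_mem' := Matrix.isSymm_zero
  smul_mem' c _ h := h.smul c

/-- The `k`-homogeneous polynomial functions on a finite dimensional complex vector space `V`:
the span of the products of `k` linear functionals. -/
def homogeneousPolynomials (k : ℕ) (V : Type*) [AddCommGroup V] [Module ℂ V] :
    Submodule ℂ (V → ℂ) :=
  Submodule.span ℂ (Set.range fun (l : Fin k → Module.Dual ℂ V) (x : V) => ∏ i, l i x)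

/-- The space `M_k` spanned by the `k × k` minors of symmetric `n × n` matrices, that is, by the
determinants of the submatrices with rows `I 0 < ⋯ < I (k-1)` and columns `J 0 < ⋯ < J (k-1)`. -/
def minorSpan (n k : ℕ) : Submodule ℂ (SM n → ℂ) :=
  Submodule.span ℂ (Set.range fun (IJ : (Fin k ↪o Fin n) × (Fin k ↪o Fin n)) (Q : SM n) =>
    (Q.1.submatrix IJ.1 IJ.2).det)

/-- The map `F_Q : ℂⁿ → ℂⁿ × (ℂⁿ)*`, `F_Q z = (z, zᵀ Q)`; here `zᵀ Q` is the differential at `z` of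
`z ↦ (zᵀ Q z) / 2`. -/
noncomputable def graphMap {n : ℕ} (Q : SM n) : (Fin n → ℂ) →ₗ[ℂ] Phase n :=
  LinearMap.prod LinearMap.id (Matrix.toLinearMap₂' ℂ Q.1)

/-- The form `dz₁ ∧ ⋯ ∧ dzₙ` on `ℂⁿ`. -/
noncomputable def volumeForm (n : ℕ) : (Fin n → ℂ) [⋀^Fin n]→ₗ[ℂ] ℂ :=
  (Pi.basisFun ℂ (Fin n)).det

end PrimitiveForms

open PrimitiveForms

namespace PrimitiveForms

/-! The polynomial of `τ` at `Q` is `τ` evaluated on the vectors `F_Q eᵢ = eᵢ + ∑ⱼ Qᵢⱼ wⱼ`, where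
`wⱼ` is the dual basis. Multilinear expansion together with the bidegree leaves the terms with
exactly `k` covectors, and Cauchy-Binet turns these into `k × k` minors of `Q`. The resulting map
`pullback` is equivariant up to a determinant, with `g` acting on `Q` by `gᵀ Q g`.

Injectivity: a coefficient of `τ` whose tuple of basis vectors contains no dual pair `eₐ, wₐ` is, up
to sign, the value of the polynomial at a diagonal 0/1 matrix. Coefficients with pairs vanish by
induction on the number of pairs. A shear shows that such a coefficient does not change when a pair
is moved to an unused index, and then `ω ∧ τ = 0`, tested on the tuple enlarged by the unused pair,
says that a positive multiple of the coefficient is zero.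

Surjectivity and irreducibility rest on one extremal form, `coordForm`, whose polynomial is the
leading principal minor. Its translates give the polynomials `∑ det g_I det g_J · minor I J`, up to
nonzero scalars, where `g_I` consists of the first `k` columns of `g` and the rows `I`. By
`sum_minor_eq_zero`, a linear relation between the products `det g_I det g_J` on the group is also a
relation between the minors. A functional that kills all translates gives a relation of the first
kind; conjugating its coefficients and applying the functional to the corresponding relation between
minors gives a vanishing sum of squares, so it kills every minor. Conversely, an invariant subspace
with a nonzero element contains a form whose polynomial does not vanish at `diag(1,…,1,0,…,0)`; a
torus element isolates that coefficient, so the subspace contains `coordForm`, hence everything. -/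

/-! ### Cauchy-Binet and the span of minors -/

/-- An alternating form evaluated at linear combinations, as a sum of minors of the coefficients
(a form of the Cauchy-Binet formula). -/
theorem factorial_mul_map_sum {M N : Type*} [AddCommGroup M] [Module ℂ M] [Fintype N]
    [DecidableEq N] {k : ℕ} (α : M [⋀^Fin k]→ₗ[ℂ] ℂ) (C : Matrix (Fin k) N ℂ) (y : N → M) :
    (k.factorial : ℂ) * α (fun a => ∑ j, C a j • y j) =
      ∑ J : Fin k → N, (C.submatrix id J).det * α (y ∘ J) := by
  have h : α (fun a => ∑ j, C a j • y j) = ∑ J : Fin k → N, (∏ a, C a (J a)) * α (y ∘ J) := by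
    rw [← AlternatingMap.coe_multilinearMap, MultilinearMap.map_sum]
    refine Finset.sum_congr rfl fun J _ => ?_
    rw [MultilinearMap.map_smul_univ]
    rfl
  -- Reindexing `J` by `σ` produces a second sign from the alternation of `α`, which cancels the
  -- Leibniz sign. All `k!` permutations thus contribute equally.
  have h2 : ∀ σ : Equiv.Perm (Fin k), ∑ J : Fin k → N,
      (((Equiv.Perm.sign σ : ℤ) : ℂ) * ∏ i, C (σ i) (J i)) * α (y ∘ J) =
        α (fun a => ∑ j, C a j • y j) := fun σ => by
    rw [h, ← (Equiv.arrowCongr σ.symm (Equiv.refl N)).sum_comp]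
    refine Finset.sum_congr rfl fun J _ => ?_
    have e : (Equiv.arrowCongr σ.symm (Equiv.refl N)) J = J ∘ σ := rfl
    rw [e, ← Function.comp_assoc, AlternatingMap.map_perm]
    have e2 : ∏ i, C (σ i) ((J ∘ σ) i) = ∏ a, C a (J a) :=
      Equiv.prod_comp σ fun a => C a (J a)
    have e3 : ((Equiv.Perm.sign σ : ℤ) : ℂ) * ((Equiv.Perm.sign σ : ℤ) : ℂ) = 1 := by
      norm_cast
      simp
    rw [e2, Units.smul_def, zsmul_eq_mul]
    linear_combination (∏ a, C a (J a)) * α (y ∘ J) * e3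
  simp only [Matrix.det_apply', Finset.sum_mul, Matrix.submatrix_apply, id]
  rw [Finset.sum_comm, Finset.sum_congr rfl fun σ _ => h2 σ]
  simp [Fintype.card_perm]

theorem factorial_mul_det_mul {N : Type*} [Fintype N] [DecidableEq N] {k : ℕ}
    (A : Matrix (Fin k) N ℂ) (B : Matrix N (Fin k) ℂ) :
    (k.factorial : ℂ) * (A * B).det =
      ∑ J : Fin k → N, (A.submatrix id J).det * (B.submatrix J id).det := by
  have e : A * B = Matrix.of fun a => ∑ f, A a f • B f := by
    ext a c
    simp [Matrix.mul_apply]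
  rw [e]
  exact factorial_mul_map_sum (Matrix.detRowAlternating (n := Fin k) (R := ℂ)) A B

/-- The minor of a symmetric matrix with given lists of rows and columns. -/
def minor {n k : ℕ} (I J : Fin k → Fin n) : SM n → ℂ := fun Q => (Q.1.submatrix I J).det

/-- A repeated index gives a zero minor; otherwise sorting rows and columns costs only signs. This
permits sums over arbitrary index tuples later. -/
theorem minor_mem_minorSpan {n k : ℕ} (I J : Fin k → Fin n) : minor I J ∈ minorSpan n k := by
  by_cases hI : Function.Injective I
  swap
  · obtain ⟨a, b, hab, hne⟩ : ∃ a b, I a = I b ∧ a ≠ b := by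
      simpa [Function.Injective] using hI
    have : minor I J = 0 := funext fun Q =>
      Matrix.det_zero_of_row_eq hne (by ext j; simp [hab])
    rw [this]
    exact zero_mem _
  by_cases hJ : Function.Injective J
  swap
  · obtain ⟨a, b, hab, hne⟩ : ∃ a b, J a = J b ∧ a ≠ b := by
      simpa [Function.Injective] using hJ
    have : minor I J = 0 := funext fun Q =>
      Matrix.det_zero_of_column_eq hne (by intro j; simp [hab])
    rw [this]
    exact zero_mem _
  have mono : ∀ I : Fin k → Fin n, Function.Injective I → StrictMono (I ∘ Tuple.sort I) :=
    fun I hI => (Tuple.monotone_sort I).strictMono_of_injective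
      (hI.comp (Tuple.sort I).injective)
  have key : minor I J = (((Equiv.Perm.sign (Tuple.sort I) : ℤ) : ℂ) *
      ((Equiv.Perm.sign (Tuple.sort J) : ℤ) : ℂ)) •
      minor (I ∘ Tuple.sort I) (J ∘ Tuple.sort J) := by
    funext Q
    have e1 : ∀ σ : Equiv.Perm (Fin k),
        ((Equiv.Perm.sign σ : ℤ) : ℂ) * ((Equiv.Perm.sign σ : ℤ) : ℂ) = 1 := fun σ => by
      norm_cast
      simp
    have e2 : minor (I ∘ Tuple.sort I) (J ∘ Tuple.sort J) Q =
        ((Equiv.Perm.sign (Tuple.sort I) : ℤ) : ℂ) *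
        (((Equiv.Perm.sign (Tuple.sort J) : ℤ) : ℂ) * minor I J Q) := by
      rw [minor, minor, ← Matrix.det_permute' (Tuple.sort J), ← Matrix.det_permute (Tuple.sort I)]
      rfl
    rw [Pi.smul_apply, e2, smul_eq_mul]
    linear_combination (-(minor I J Q)) * (((Equiv.Perm.sign (Tuple.sort J) : ℤ) : ℂ) ^ 2 *
      e1 (Tuple.sort I) + e1 (Tuple.sort J))
  rw [key]
  refine Submodule.smul_mem _ _ (Submodule.subset_span ⟨⟨OrderEmbedding.ofStrictMono _ (mono I hI),
    OrderEmbedding.ofStrictMono _ (mono J hJ)⟩, rfl⟩)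

theorem exists_sum_minor_of_mem_minorSpan {n k : ℕ} {f : SM n → ℂ} (hf : f ∈ minorSpan n k) :
    ∃ φ : (Fin k → Fin n) → (Fin k → Fin n) → ℂ, ∀ Q, f Q = ∑ I, ∑ J, φ I J * minor I J Q := by
  induction hf using Submodule.span_induction with
  | mem f hf =>
    obtain ⟨⟨I, J⟩, rfl⟩ := hf
    classical
    refine ⟨fun I' J' => if I' = I then if J' = J then 1 else 0 else 0, fun Q => ?_⟩
    simp [minor]
  | zero => exact ⟨fun _ _ => 0, fun Q => by simp⟩
  | add f g _ _ hf hg =>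
    obtain ⟨φ, hφ⟩ := hf
    obtain ⟨ψ, hψ⟩ := hg
    exact ⟨fun I J => φ I J + ψ I J, fun Q => by
      simp [hφ, hψ, add_mul, Finset.sum_add_distrib]⟩
  | smul c f _ hf =>
    obtain ⟨φ, hφ⟩ := hf
    exact ⟨fun I J => c * φ I J, fun Q => by simp [hφ, Finset.mul_sum, mul_assoc]⟩

theorem minorSpan_le_homogeneousPolynomials (n k : ℕ) :
    minorSpan n k ≤ homogeneousPolynomials k (SM n) := by
  refine Submodule.span_le.2 ?_
  rintro _ ⟨⟨I, J⟩, rfl⟩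
  have : (fun Q : SM n => (Q.1.submatrix I J).det) =
      ∑ σ : Equiv.Perm (Fin k), ((Equiv.Perm.sign σ : ℤ) : ℂ) •
        fun Q : SM n => ∏ i, (((LinearMap.proj (J i)).comp (LinearMap.proj (I (σ i)))).comp
          (SM n).subtype : Module.Dual ℂ (SM n)) Q := by
    funext Q
    simp only [Matrix.det_apply', Finset.sum_apply, Pi.smul_apply, smul_eq_mul]
    rfl
  change (fun Q : SM n => (Q.1.submatrix I J).det) ∈ _
  rw [this]
  exact Submodule.sum_mem _ fun σ _ => Submodule.smul_mem _ _ (Submodule.subset_span ⟨_, rfl⟩)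

/-! ### Relations between minors, from the group to symmetric matrices -/

/-- Polynomial identities in the maximal minors of the first columns extend from invertible
matrices to all matrices. -/
theorem sum_det_mul_det_eq_zero {n k : ℕ} (hk : k ≤ n)
    (φ : (Fin k → Fin n) → (Fin k → Fin n) → ℂ)
    (h : ∀ g : GL (Fin n) ℂ, ∑ I, ∑ J, φ I J * ((g.1.submatrix I (Fin.castLE hk)).det *
      (g.1.submatrix J (Fin.castLE hk)).det) = 0) (X : Matrix (Fin n) (Fin k) ℂ) :
    ∑ I, ∑ J, φ I J * ((X.submatrix I id).det * (X.submatrix J id).det) = 0 := by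
  -- The sign makes the first `k` columns of `t - G` equal to `X` at `t = 0`, while `t - G` is
  -- invertible away from the roots of the characteristic polynomial.
  set G : Matrix (Fin n) (Fin n) ℂ :=
    Matrix.of fun i a => if ha : a.1 < k then - X i ⟨a.1, ha⟩ else 0 with hG
  let D : (Fin k → Fin n) → Polynomial ℂ := fun I => (G.charmatrix.submatrix I (Fin.castLE hk)).det
  let p : Polynomial ℂ := ∑ I, ∑ J, Polynomial.C (φ I J) * (D I * D J)
  have ev : ∀ t : ℂ, G.charmatrix.map (Polynomial.eval t) = Matrix.scalar _ t - G := fun t => by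
    ext i j
    by_cases hij : i = j
    · subst hij
      simp [Matrix.charmatrix]
    · simp [Matrix.charmatrix, hij]
  have evD : ∀ (t : ℂ) I, (D I).eval t =
      ((Matrix.scalar _ t - G).submatrix I (Fin.castLE hk)).det := fun t I => by
    rw [← ev, ← Polynomial.coe_evalRingHom, RingHom.map_det]
    rfl
  have evp : ∀ t, p.eval t = ∑ I, ∑ J, φ I J *
      (((Matrix.scalar _ t - G).submatrix I (Fin.castLE hk)).det *
      ((Matrix.scalar _ t - G).submatrix J (Fin.castLE hk)).det) := fun t => by
    simp only [p, Polynomial.eval_finsetSum, Polynomial.eval_mul, Polynomial.eval_C, evD]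
  have hp : p * G.charpoly = 0 := by
    refine Polynomial.funext fun t => ?_
    rw [Polynomial.eval_mul, Polynomial.eval_zero]
    by_cases ht : G.charpoly.eval t = 0
    · rw [ht, mul_zero]
    · have hd : (Matrix.scalar _ t - G).det ≠ 0 := by
        rwa [← Matrix.eval_charpoly]
      have := h (Matrix.GeneralLinearGroup.mkOfDetNeZero _ hd)
      rw [evp]
      rw [mul_eq_zero]
      exact Or.inl this
  have hp0 : p = 0 := (mul_eq_zero.1 hp).resolve_right (Matrix.charpoly_monic G).ne_zero
  have := evp 0
  rw [hp0, Polynomial.eval_zero] at this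
  rw [this]
  refine Finset.sum_congr rfl fun I _ => Finset.sum_congr rfl fun J _ => ?_
  have e : ∀ I : Fin k → Fin n, X.submatrix I id =
      (Matrix.scalar _ 0 - G).submatrix I (Fin.castLE hk) := fun I => by
    ext a b
    simp [hG]
  rw [e, e]

/-- Every symmetric `Q` has the form `Y diag(d) Yᵀ`, so by Cauchy-Binet its minors are combinations,
with coefficients independent of `I` and `J`, of products `det X_I det X_J` for matrices `X` formed
from `k` columns of `Y`. -/
theorem sum_minor_eq_zero {n k : ℕ} (hk : k ≤ n)
    (φ : (Fin k → Fin n) → (Fin k → Fin n) → ℂ)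
    (h : ∀ g : GL (Fin n) ℂ, ∑ I, ∑ J, φ I J * ((g.1.submatrix I (Fin.castLE hk)).det *
      (g.1.submatrix J (Fin.castLE hk)).det) = 0) (Q : SM n) :
    ∑ I, ∑ J, φ I J * minor I J Q = 0 := by
  let s : Bool → ℂ := fun b => if b then 1 else -1
  -- Polarisation: the columns are `e_p ± e_q` with weights `± Q_pq / 4`, and the two signs add up
  -- to `Q_pq / 2 · (e_p e_qᵀ + e_q e_pᵀ)`. Summing over ordered pairs `(p, q)` gives `Q`.
  let Y : Matrix (Fin n) (Fin n × Fin n × Bool) ℂ :=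
    Matrix.of fun i f => (if i = f.1 then 1 else 0) + s f.2.2 * (if i = f.2.1 then 1 else 0)
  let d : Fin n × Fin n × Bool → ℂ := fun f => s f.2.2 * Q.1 f.1 f.2.1 / 4
  have hQ : ∀ i j, Q.1 i j = ∑ f, Y i f * (d f * Y j f) := fun i j => by
    have hs : Q.1 j i = Q.1 i j := Q.2.apply i j
    have e : ∀ p q : Fin n, ∑ b, Y i (p, q, b) * (d (p, q, b) * Y j (p, q, b)) =
        (if i = p then if j = q then Q.1 p q / 2 else 0 else 0) +
        (if j = p then if i = q then Q.1 p q / 2 else 0 else 0) := fun p q => by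
      simp only [Fintype.sum_bool, Y, d, s, Matrix.of_apply]
      split_ifs <;> simp_all <;> ring
    simp only [Fintype.sum_prod_type, e, Finset.sum_add_distrib]
    simp [hs]
  have hm : ∀ I J : Fin k → Fin n, (k.factorial : ℂ) * minor I J Q =
      ∑ f : Fin k → Fin n × Fin n × Bool, (∏ a, d (f a)) *
        ((Y.submatrix I f).det * (Y.submatrix J f).det) := fun I J => by
    have e : Q.1.submatrix I J = Y.submatrix I id * Matrix.of fun f c => d f * Y (J c) f := by
      ext a c
      simp [hQ, Matrix.mul_apply]
    rw [minor, e, factorial_mul_det_mul]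
    refine Finset.sum_congr rfl fun f _ => ?_
    have e2 : ((Matrix.of fun f c => d f * Y (J c) f).submatrix f id).det =
        (∏ a, d (f a)) * (Y.submatrix J f).det := by
      rw [← Matrix.det_transpose (Y.submatrix J f), ← Matrix.det_mul_column]
      rfl
    rw [e2, Matrix.submatrix_submatrix, Function.comp_id, Function.id_comp]
    ring
  have hX := sum_det_mul_det_eq_zero hk φ h
  have hfac : (k.factorial : ℂ) ≠ 0 := by exact_mod_cast k.factorial_ne_zero
  refine (mul_eq_zero.1 ?_).resolve_left hfac
  calc (k.factorial : ℂ) * ∑ I, ∑ J, φ I J * minor I J Q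
      = ∑ I, ∑ J, ∑ f : Fin k → Fin n × Fin n × Bool, φ I J * ((∏ a, d (f a)) *
        ((Y.submatrix I f).det * (Y.submatrix J f).det)) := by
        simp only [← Finset.mul_sum, ← hm]
        simp only [Finset.mul_sum]
        refine Finset.sum_congr rfl fun I _ => Finset.sum_congr rfl fun J _ => by ring
    _ = ∑ f : Fin k → Fin n × Fin n × Bool, ∑ I, ∑ J, φ I J * ((∏ a, d (f a)) *
        ((Y.submatrix I f).det * (Y.submatrix J f).det)) := by
        simp only [fun I => Finset.sum_comm (s := (Finset.univ : Finset (Fin k → Fin n)))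
          (t := (Finset.univ : Finset (Fin k → Fin n × Fin n × Bool)))
          (f := fun J f => φ I J * ((∏ a, d (f a)) *
          ((Y.submatrix I f).det * (Y.submatrix J f).det)))]
        exact Finset.sum_comm
    _ = 0 := by
        refine Finset.sum_eq_zero fun f _ => ?_
        have := hX (Y.submatrix id f)
        simp only [Matrix.submatrix_submatrix, Function.comp_id, Function.id_comp] at this
        rw [← mul_zero (∏ a, d (f a)), ← this]
        simp only [Finset.mul_sum]
        refine Finset.sum_congr rfl fun I _ => Finset.sum_congr rfl fun J _ => by ring


/-! ### Pull-back to graphs and its equivariance -/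

/-- The coefficient of the pull-back of a form to the graph of a symmetric matrix. -/
noncomputable def pullback (n : ℕ) : Form n →ₗ[ℂ] (SM n → ℂ) where
  toFun τ Q := τ fun i => graphMap Q (Pi.single i 1)
  map_add' _ _ := rfl
  map_smul' _ _ := rfl

theorem pullback_apply {n : ℕ} (τ : Form n) (Q : SM n) :
    pullback n τ Q = τ fun i => graphMap Q (Pi.single i 1) := rfl

theorem volumeForm_single (n : ℕ) : volumeForm n (fun i => Pi.single i 1) = 1 := by
  have : (fun i => Pi.single i (1 : ℂ)) = Pi.basisFun ℂ (Fin n) := by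
    ext i; simp
  rw [volumeForm, this, Module.Basis.det_self]

theorem compLinearMap_graphMap {n : ℕ} (τ : Form n) (Q : SM n) :
    τ.compLinearMap (graphMap Q) = pullback n τ Q • volumeForm n := by
  rw [(τ.compLinearMap (graphMap Q)).eq_smul_basis_det (Pi.basisFun ℂ (Fin n))]
  simp [pullback_apply, volumeForm]

/-- The basis of the phase space which consists of the standard basis vectors and their duals. -/
noncomputable def phaseBasis (n : ℕ) : Module.Basis (Fin n ⊕ Fin n) ℂ (Phase n) :=
  (Pi.basisFun ℂ (Fin n)).prod (Pi.basisFun ℂ (Fin n)).dualBasis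

theorem phaseBasis_inl {n : ℕ} (i : Fin n) : phaseBasis n (Sum.inl i) = (Pi.single i 1, 0) := by
  simp [phaseBasis]

theorem phaseBasis_inr {n : ℕ} (i : Fin n) :
    phaseBasis n (Sum.inr i) = (0, LinearMap.proj i) := by
  simp only [phaseBasis, Module.Basis.prod_apply, Sum.elim_inr, Function.comp, LinearMap.inr_apply]
  congr 1
  ext j
  simp [Module.Basis.coe_dualBasis, Pi.single_apply]

theorem graphMap_single {n : ℕ} (Q : SM n) (i : Fin n) :
    graphMap Q (Pi.single i 1) =
      ((0, ∑ j, Q.1 i j • LinearMap.proj j) : Phase n) + (Pi.single i 1, 0) := by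
  refine Prod.ext ?_ ?_
  · simp [graphMap]
  · ext j
    simp [graphMap, Pi.single_apply, Matrix.toLinearMap₂'_apply']

/-- A form with the vectors of `ℂⁿ` at the positions outside of a set `S` replaced by the standard
basis vectors, as a form in the covectors at the positions in `S`. -/
noncomputable def covectorForm {n k : ℕ} (τ : Form n) (S : Finset (Fin n)) (e : Fin k ≃ S) :
    Module.Dual ℂ (Fin n → ℂ) [⋀^Fin k]→ₗ[ℂ] ℂ :=
  have upd : ∀ [DecidableEq (Fin k)] (η : Fin k → Module.Dual ℂ (Fin n → ℂ)) (a : Fin k)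
      (x : Module.Dual ℂ (Fin n → ℂ)),
      (fun i => if h : i ∈ S then ((0, Function.update η a x (e.symm ⟨i, h⟩)) : Phase n)
        else (Pi.single i 1, 0)) = Function.update (fun i => if h : i ∈ S then
          ((0, η (e.symm ⟨i, h⟩)) : Phase n) else (Pi.single i 1, 0)) (e a) (0, x) := by
    intro _ η a x
    funext i
    by_cases hi : i = e a
    · subst hi
      simp
    · rw [Function.update_of_ne hi]
      by_cases h : i ∈ S
      · have : e.symm ⟨i, h⟩ ≠ a := fun h2 => hi (by rw [← h2]; simp)
        simp [h, Function.update_of_ne this]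
      · simp [h]
  { toFun := fun η => τ fun i => if h : i ∈ S then (0, η (e.symm ⟨i, h⟩)) else (Pi.single i 1, 0)
    map_update_add' := by
      intro _ η a x y
      rw [upd, upd, upd, ← AlternatingMap.map_update_add]
      simp
    map_update_smul' := by
      intro _ η a c x
      rw [upd, upd, ← AlternatingMap.map_update_smul]
      simp
    map_eq_zero_of_eq' := by
      intro η a b hab hne
      refine τ.map_eq_zero_of_eq _ (i := e a) (j := e b) ?_ ?_
      · simp [hab]
      · intro h
        exact hne (e.injective (Subtype.ext h)) }

/-- Expanding each `F_Q eᵢ` gives one term for every set `S` of positions filled by covectors. The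
bidegree kills the terms with `|S| ≠ k`, and Cauchy-Binet expands the others in minors with rows
`S`. -/
theorem pullback_mem_minorSpan {n k : ℕ} {τ : Form n} (hτ : τ ∈ bidegree n k) :
    pullback n τ ∈ minorSpan n k := by
  have hs : ∀ S : Finset (Fin n), (fun Q : SM n => τ (S.piecewise
      (fun i => (0, ∑ j, Q.1 i j • LinearMap.proj j)) fun i => (Pi.single i 1, 0))) ∈
      minorSpan n k := by
    intro S
    by_cases hS : S.card = k
    · let e : Fin k ≃ S := (S.orderIsoOfFin hS).toEquiv
      have : (fun Q : SM n => τ (S.piecewise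
          (fun i => (0, ∑ j, Q.1 i j • LinearMap.proj j)) fun i => (Pi.single i 1, 0))) =
          (k.factorial : ℂ)⁻¹ • ∑ J : Fin k → Fin n,
          covectorForm τ S e (LinearMap.proj ∘ J) • minor (fun a => (e a : Fin n)) J := by
        funext Q
        have h := factorial_mul_map_sum (covectorForm τ S e)
          (Q.1.submatrix (fun a => (e a : Fin n)) id) (fun j => LinearMap.proj j)
        have hfac : (k.factorial : ℂ) ≠ 0 := by exact_mod_cast k.factorial_ne_zero
        rw [Pi.smul_apply, smul_eq_mul, eq_inv_mul_iff_mul_eq₀ hfac]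
        refine Eq.trans ?_ (h.trans ?_)
        · congr 1
          simp only [covectorForm, AlternatingMap.coe_mk, MultilinearMap.coe_mk]
          congr 1
          funext i
          by_cases hi : i ∈ S <;> simp [hi]
        · rw [Finset.sum_apply]
          refine Finset.sum_congr rfl fun J _ => ?_
          rw [Pi.smul_apply, smul_eq_mul, mul_comm]
          rfl
      rw [this]
      exact Submodule.smul_mem _ _ (Submodule.sum_mem _ fun J _ =>
        Submodule.smul_mem _ _ (minor_mem_minorSpan _ _))
    · have : (fun Q : SM n => τ (S.piecewise
          (fun i => (0, ∑ j, Q.1 i j • LinearMap.proj j)) fun i => (Pi.single i 1, 0))) = 0 := by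
        funext Q
        refine hτ S _ hS (fun i hi => ?_) fun i hi => ?_
        · simp [hi]
        · simp [hi]
      rw [this]
      exact zero_mem _
  have : pullback n τ = ∑ S : Finset (Fin n), fun Q : SM n => τ (S.piecewise
      (fun i => (0, ∑ j, Q.1 i j • LinearMap.proj j)) fun i => (Pi.single i 1, 0)) := by
    funext Q
    rw [pullback_apply, Finset.sum_apply]
    simp only [graphMap_single]
    exact τ.toMultilinearMap.map_add_univ _ _
  rw [this]
  exact Submodule.sum_mem _ fun S _ => hs S

/-- The action of matrices on symmetric matrices. -/
def congruence {n : ℕ} (g : Matrix (Fin n) (Fin n) ℂ) (Q : SM n) : SM n :=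
  ⟨gᵀ * Q.1 * g, by
    have : Q.1ᵀ = Q.1 := Q.2
    change _ = _
    simp [Matrix.transpose_mul, this, Matrix.mul_assoc]⟩

/-- The map `g^#` carries the graph of `Q` to the graph of `gᵀ Q g`, acting on the base by `g⁻¹`,
whence the determinant factor. -/
theorem pullback_formRep {n : ℕ} (g : GL (Fin n) ℂ) (τ : Form n) (Q : SM n) :
    pullback n (formRep n g τ) Q = (g⁻¹).1.det * pullback n τ (congruence g.1 Q) := by
  have e : ∀ z, sharp g (graphMap Q z) =
      graphMap (congruence g.1 Q) (Matrix.toLin' (g⁻¹).1 z) := fun z => by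
    refine Prod.ext ?_ ?_
    · simp [sharp, graphMap]
    · refine LinearMap.ext fun x => ?_
      have h : g.1 *ᵥ ((g⁻¹).1 *ᵥ z) = z := by
        rw [Matrix.mulVec_mulVec, ← Units.val_mul, mul_inv_cancel, Units.val_one,
          Matrix.one_mulVec]
      change Matrix.toLinearMap₂' ℂ Q.1 z (g.1 *ᵥ x) =
        Matrix.toLinearMap₂' ℂ (g.1ᵀ * Q.1 * g.1) ((g⁻¹).1 *ᵥ z) x
      rw [Matrix.toLinearMap₂'_apply', Matrix.toLinearMap₂'_apply']
      rw [← Matrix.mulVec_mulVec, ← Matrix.mulVec_mulVec, 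
        Matrix.dotProduct_mulVec ((g⁻¹).1 *ᵥ z), Matrix.vecMul_transpose, h]
  have h2 : pullback n (formRep n g τ) Q = (τ.compLinearMap (graphMap (congruence g.1 Q)))
      (Matrix.toLin' (g⁻¹).1 ∘ fun i => Pi.single i 1) := by
    rw [pullback_apply, formRep_apply]
    simp only [AlternatingMap.compLinearMap_apply, Function.comp, e]
  rw [h2, compLinearMap_graphMap, AlternatingMap.smul_apply, volumeForm,
    Module.Basis.det_comp, LinearMap.det_toLin', ← volumeForm, volumeForm_single]
  simp [mul_comm]


/-! ### Primitivity as a sum over permutations -/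

/-- The wedge product with the symplectic form as a sum over all permutations. -/
theorem wedge_symplecticForm_apply {n : ℕ} (τ : Form n) (v : Fin 2 ⊕ Fin n → Phase n) :
    ((2 * n.factorial : ℕ) : ℂ) * wedge (symplecticForm n) τ v =
      ∑ σ : Equiv.Perm (Fin 2 ⊕ Fin n), ((Equiv.Perm.sign σ : ℤ) : ℂ) *
        (symplecticForm n (fun i => v (σ (Sum.inl i))) * τ fun i => v (σ (Sum.inr i))) := by
  have h := congrArg (fun β => (LinearMap.mul' ℂ ℂ).compAlternatingMap β v)
    (MultilinearMap.domCoprod_alternization_eq (symplecticForm n) τ)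
  have h2 : (2 * n.factorial : ℕ) = (Fintype.card (Fin 2)).factorial *
    (Fintype.card (Fin n)).factorial := by simp
  rw [h2]
  refine Eq.trans ?_ (h.symm.trans ?_)
  · simp only [wedge, LinearMap.compAlternatingMap_apply, AlternatingMap.smul_apply]
    rw [map_nsmul, nsmul_eq_mul]
  · simp only [LinearMap.compAlternatingMap_apply, MultilinearMap.alternatization_apply, map_sum]
    refine Finset.sum_congr rfl fun σ _ => ?_
    rw [Units.smul_def, map_zsmul, zsmul_eq_mul]
    simp

theorem wedge_symplecticForm_eq_zero_iff {n : ℕ} (τ : Form n) :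
    wedge (symplecticForm n) τ = 0 ↔ ∀ v : Fin 2 ⊕ Fin n → Fin n ⊕ Fin n, Function.Injective v →
      ∑ σ : Equiv.Perm (Fin 2 ⊕ Fin n), ((Equiv.Perm.sign σ : ℤ) : ℂ) *
        (symplecticForm n (fun i => phaseBasis n (v (σ (Sum.inl i)))) *
          τ fun i => phaseBasis n (v (σ (Sum.inr i)))) = 0 := by
  refine ⟨fun h v _ => ?_, fun h => ?_⟩
  · rw [← wedge_symplecticForm_apply τ fun i => phaseBasis n (v i), h]
    simp
  · refine Module.Basis.ext_alternating (phaseBasis n) fun v hv => ?_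
    have := wedge_symplecticForm_apply τ fun i => phaseBasis n (v i)
    rw [h v hv] at this
    have hfac : ((2 * n.factorial : ℕ) : ℂ) ≠ 0 := by
      exact_mod_cast (mul_pos two_pos n.factorial_pos).ne'
    exact (mul_eq_zero.1 this).resolve_left hfac

theorem symplecticForm_apply {n : ℕ} (v : Fin 2 → Phase n) :
    symplecticForm n v = (v 1).2 (v 0).1 - (v 0).2 (v 1).1 := rfl

/-! ### The extremal form -/

/-- The projection to `ℂⁿ` along a coordinate Lagrangian subspace. -/
def coordProj (n k : ℕ) : Phase n →ₗ[ℂ] (Fin n → ℂ) where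
  toFun x j := if j.1 < k then x.2 (Pi.single j 1) else x.1 j
  map_add' x y := by ext j; by_cases h : j.1 < k <;> simp [h]
  map_smul' c x := by ext j; by_cases h : j.1 < k <;> simp [h]

theorem coordProj_apply {n k : ℕ} (x : Phase n) (j : Fin n) :
    coordProj n k x j = if j.1 < k then x.2 (Pi.single j 1) else x.1 j := rfl

/-- The form `dw₁ ∧ ⋯ ∧ dwₖ ∧ dzₖ₊₁ ∧ ⋯ ∧ dzₙ`. -/
noncomputable def coordForm (n k : ℕ) : Form n := (volumeForm n).compLinearMap (coordProj n k)

theorem coordForm_apply {n k : ℕ} (v : Fin n → Phase n) :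
    coordForm n k v = (Matrix.of fun i j => coordProj n k (v j) i).det := by
  simp only [coordForm, AlternatingMap.compLinearMap_apply, volumeForm, Module.Basis.det_apply]
  congr 1

theorem coordForm_mem_bidegree {n k : ℕ} (hk : k ≤ n) : coordForm n k ∈ bidegree n k := by
  intro S v hS h1 h2
  rw [coordForm_apply, Matrix.det_apply]
  refine Finset.sum_eq_zero fun σ _ => ?_
  suffices h : ∏ i, (Matrix.of fun i j => coordProj n k (v j) i) (σ i) i = 0 by rw [h, smul_zero]
  by_contra hne
  rw [← ne_eq, Finset.prod_ne_zero_iff] at hne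
  refine hS ?_
  -- In a nonzero Leibniz term, the permutation must match covector slots with the `dw` rows, so `S`
  -- has exactly `k` elements.
  have hmap : S.map σ.toEmbedding = Finset.univ.filter fun i : Fin n => i.1 < k := by
    ext j
    obtain ⟨i, rfl⟩ := σ.surjective j
    have := hne i (Finset.mem_univ _)
    simp only [Matrix.of_apply, coordProj_apply] at this
    simp only [Finset.mem_map_equiv, Equiv.symm_apply_apply, Finset.mem_filter, Finset.mem_univ,
      true_and]
    constructor
    · intro hi
      by_contra hlt
      simp [hlt, h1 i hi] at this
    · intro hlt
      by_contra hi
      simp [hlt, h2 i hi] at this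
  have := congrArg Finset.card hmap
  rw [Finset.card_map] at this
  rw [this]
  rw [Fin.card_filter_val_lt]
  exact min_eq_right hk

/-- The basis vectors which `coordProj` maps to the standard basis. -/
def coordSection {n : ℕ} (k : ℕ) (j : Fin n) : Fin n ⊕ Fin n :=
  if j.1 < k then Sum.inr j else Sum.inl j

theorem coordProj_coordSection {n k : ℕ} (j : Fin n) :
    coordProj n k (phaseBasis n (coordSection k j)) = Pi.single j 1 := by
  ext i
  by_cases h : j.1 < k
  · rw [coordSection, if_pos h, phaseBasis_inr, coordProj_apply]
    by_cases hi : i.1 < k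
    · simp [hi, Pi.single_apply, eq_comm]
    · have : i ≠ j := fun e => hi (e ▸ h)
      simp [hi, this]
  · rw [coordSection, if_neg h, phaseBasis_inl, coordProj_apply]
    by_cases hi : i.1 < k
    · have : i ≠ j := fun e => h (e ▸ hi)
      simp [hi, this]
    · simp [hi]

theorem coordProj_eq_zero {n k : ℕ} {s : Fin n ⊕ Fin n} (hs : s ∉ Set.range (coordSection k)) :
    coordProj n k (phaseBasis n s) = 0 := by
  ext i
  rcases s with j | j
  · have hj : j.1 < k := by
      by_contra h
      exact hs ⟨j, by simp [coordSection, h]⟩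
    rw [phaseBasis_inl, coordProj_apply]
    by_cases hi : i.1 < k
    · simp [hi]
    · have : i ≠ j := fun e => hi (e ▸ hj)
      simp [hi, this]
  · have hj : ¬ j.1 < k := by
      intro h
      exact hs ⟨j, by simp [coordSection, h]⟩
    rw [phaseBasis_inr, coordProj_apply]
    by_cases hi : i.1 < k
    · have : i ≠ j := fun e => hj (e ▸ hi)
      simp [hi, this.symm]
    · simp [hi]

theorem coordForm_coordSection (n k : ℕ) :
    coordForm n k (fun j => phaseBasis n (coordSection k j)) = 1 := by
  simp only [coordForm, AlternatingMap.compLinearMap_apply, coordProj_coordSection,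
    volumeForm_single]

theorem coordForm_eq_zero {n k : ℕ} {s : Fin n → Fin n ⊕ Fin n} {i : Fin n}
    (hi : s i ∉ Set.range (coordSection k)) :
    coordForm n k (fun j => phaseBasis n (s j)) = 0 := by
  rw [coordForm, AlternatingMap.compLinearMap_apply]
  exact AlternatingMap.map_coord_zero _ i (coordProj_eq_zero hi)

/-- An injective tuple of `n` elements of the range of `coordSection` is a permutation of it. -/
theorem exists_perm_of_mem_range {n k : ℕ} {s : Fin n → Fin n ⊕ Fin n} (hs : Function.Injective s)
    (h : ∀ i, s i ∈ Set.range (coordSection k)) :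
    ∃ σ : Equiv.Perm (Fin n), ∀ i, s i = coordSection k (σ i) := by
  choose σ hσ using h
  have : Function.Injective σ := fun a b hab => hs (by rw [← hσ, ← hσ, hab])
  exact ⟨Equiv.ofBijective σ (Finite.injective_iff_bijective.1 this), fun i => (hσ i).symm⟩

/-- A term with nonzero form factor uses all the vectors of `coordSection`. The two vectors left for
`ω` then lie in the complementary coordinate subspace, which is Lagrangian. -/
theorem coordForm_mem_primitive {n k : ℕ} (hk : k ≤ n) : coordForm n k ∈ primitive n k := by
  refine ⟨coordForm_mem_bidegree hk, (wedge_symplecticForm_eq_zero_iff _).2 fun v hv => ?_⟩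
  refine Finset.sum_eq_zero fun σ _ => ?_
  by_cases h : ∀ i, v (σ (Sum.inr i)) ∈ Set.range (coordSection k)
  · obtain ⟨ρ, hρ⟩ := exists_perm_of_mem_range
      (hv.comp (σ.injective.comp Sum.inr_injective)) h
    have hnot : ∀ a j, v (σ (Sum.inl a)) ≠ coordSection k j := fun a j e => by
      have := hρ (ρ.symm j)
      rw [Equiv.apply_symm_apply, ← e] at this
      have := σ.injective (hv this)
      simp at this
    have hform : ∀ a, ∃ j : Fin n, v (σ (Sum.inl a)) =
        if j.1 < k then Sum.inl j else Sum.inr j := fun a => by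
      rcases hva : v (σ (Sum.inl a)) with j | j
      · refine ⟨j, ?_⟩
        by_cases hj : j.1 < k
        · simp [hj]
        · exact absurd (by simp [coordSection, hj, hva]) (hnot a j)
      · refine ⟨j, ?_⟩
        by_cases hj : j.1 < k
        · exact absurd (by simp [coordSection, hj, hva]) (hnot a j)
        · simp [hj]
    obtain ⟨p, hp⟩ := hform 0
    obtain ⟨q, hq⟩ := hform 1
    have : symplecticForm n (fun i => phaseBasis n (v (σ (Sum.inl i)))) = 0 := by
      rw [symplecticForm_apply, hp, hq]
      by_cases h1 : p.1 < k <;> by_cases h2 : q.1 < k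
      · simp [h1, h2, phaseBasis_inl]
      · have : p ≠ q := fun e => h2 (e ▸ h1)
        simp [h1, h2, phaseBasis_inl, phaseBasis_inr, this.symm]
      · have : p ≠ q := fun e => h1 (e ▸ h2)
        simp [h1, h2, phaseBasis_inl, phaseBasis_inr, this]
      · simp [h1, h2, phaseBasis_inr]
    rw [this, zero_mul, mul_zero]
  · push Not at h
    obtain ⟨i, hi⟩ := h
    rw [coordForm_eq_zero (s := fun i => v (σ (Sum.inr i))) hi, mul_zero, mul_zero]

theorem pullback_coordForm {n k : ℕ} (hk : k ≤ n) :
    pullback n (coordForm n k) = minor (Fin.castLE hk) (Fin.castLE hk) := by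
  funext Q
  have hQ : ∀ i j, Q.1 j i = Q.1 i j := fun i j => Q.2.apply i j
  rw [pullback_apply, coordForm_apply]
  have hM : ∀ i j, coordProj n k (graphMap Q (Pi.single j 1)) i =
      if i.1 < k then Q.1 i j else if i = j then 1 else 0 := fun i j => by
    rw [coordProj_apply, graphMap_single]
    by_cases hi : i.1 < k
    · simp [hi, Pi.single_apply, hQ]
    · simp [hi, Pi.single_apply]
  rw [Matrix.twoBlockTriangular_det _ fun i => i.1 < k]
  · have h1 : (Matrix.toSquareBlockProp (Matrix.of fun i j =>
        coordProj n k (graphMap Q (Pi.single j 1)) i) fun i => ¬ i.1 < k) = 1 := by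
      ext ⟨i, hi⟩ ⟨j, hj⟩
      simp [Matrix.toSquareBlockProp_def, hM, Matrix.one_apply, hi]
    let e : Fin k ≃ {i : Fin n // i.1 < k} :=
      { toFun := fun a => ⟨Fin.castLE hk a, a.2⟩
        invFun := fun i => ⟨i.1.1, i.2⟩
        left_inv := fun a => rfl
        right_inv := fun i => rfl }
    rw [h1, Matrix.det_one, mul_one, ← Matrix.det_submatrix_equiv_self e, minor]
    congr 1
    ext a b
    simp [Matrix.toSquareBlockProp_def, hM, e]
  · intro i hi j hj
    have : i ≠ j := fun e => hi (e ▸ hj)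
    simp [hM, hi, this]


/-! ### Injectivity of the pull-back -/

/-- A form of bidegree `(n-k, k)` vanishes on tuples of basis vectors with a number of covectors
different from `k`. -/
theorem map_phaseBasis_eq_zero {n k : ℕ} {τ : Form n} (hτ : τ ∈ bidegree n k)
    (s : Fin n → Fin n ⊕ Fin n)
    (hs : (Finset.univ.filter fun i => (s i).isRight = true).card ≠ k) :
    τ (fun i => phaseBasis n (s i)) = 0 := by
  refine hτ _ _ hs (fun i hi => ?_) fun i hi => ?_
  · rcases h : s i with j | j
    · simp [h] at hi
    · simp [phaseBasis_inr]
  · rcases h : s i with j | j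
    · simp [phaseBasis_inl]
    · simp [h] at hi

/-- The indices `b` for which both the `b`-th standard basis vector and its dual occur in a tuple
of basis vectors. -/
def pairedIndices {n : ℕ} (s : Fin n → Fin n ⊕ Fin n) : Finset (Fin n) :=
  Finset.univ.filter fun b => (∃ i, s i = Sum.inl b) ∧ ∃ i, s i = Sum.inr b

theorem mem_pairedIndices {n : ℕ} {s : Fin n → Fin n ⊕ Fin n} {b : Fin n} :
    b ∈ pairedIndices s ↔ (∃ i, s i = Sum.inl b) ∧ ∃ i, s i = Sum.inr b := by
  simp [pairedIndices]

/-- The symmetric matrix of the orthogonal projection to a coordinate subspace. -/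
def diagonalOn {n : ℕ} (B : Finset (Fin n)) : SM n :=
  ⟨Matrix.diagonal fun i => if i ∈ B then 1 else 0, Matrix.isSymm_diagonal _⟩

/-- In the expansion over sets `S` of covector positions, `|S| = k` is forced by the bidegree and `S
⊆ B` by the zero diagonal entries, so only `S = B` survives. -/
theorem pullback_diagonal {n k : ℕ} {τ : Form n} (hτ : τ ∈ bidegree n k) {B : Finset (Fin n)}
    (hB : B.card = k) : pullback n τ (diagonalOn B) =
      τ fun i => phaseBasis n (if i ∈ B then Sum.inr i else Sum.inl i) := by
  have hg : ∀ i, graphMap (diagonalOn B) (Pi.single i 1) =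
      ((0, if i ∈ B then LinearMap.proj i else 0) : Phase n) + (Pi.single i 1, 0) := fun i => by
    rw [graphMap_single]
    congr 2
    rw [Finset.sum_eq_single i]
    · by_cases hi : i ∈ B <;> simp [diagonalOn, hi]
    · intro j _ hj
      simp [diagonalOn, hj.symm]
    · simp
  rw [pullback_apply]
  simp only [hg]
  refine (τ.toMultilinearMap.map_add_univ
    (fun i => ((0, if i ∈ B then LinearMap.proj i else 0) : Phase n))
    (fun i => (Pi.single i 1, 0))).trans ?_
  rw [Finset.sum_eq_single B]
  · change τ _ = τ _
    congr 1
    funext i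
    by_cases hi : i ∈ B
    · simp [hi, phaseBasis_inr]
    · simp [hi, phaseBasis_inl]
  · intro S _ hS
    by_cases hc : S.card = k
    · have : ¬ S ⊆ B := fun h => hS (Finset.eq_of_subset_of_card_le h (by omega))
      obtain ⟨i, hi, hiB⟩ := Finset.not_subset.1 this
      refine τ.map_coord_zero i ?_
      simp [hi, hiB]
    · refine hτ S _ hc (fun i hi => ?_) fun i hi => ?_
      · simp [hi]
      · simp [hi]
  · simp

/-- Without pairs the `n` slots carry distinct indices. After a permutation slot `i` holds `eᵢ` or
`wᵢ`, and the coefficient is read off at a diagonal 0/1 matrix. -/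
theorem map_eq_zero_of_pairedIndices_eq_empty {n k : ℕ} {τ : Form n} (hτ : τ ∈ bidegree n k)
    (h0 : pullback n τ = 0) {s : Fin n → Fin n ⊕ Fin n} (hs : Function.Injective s)
    (hp : pairedIndices s = ∅) : τ (fun i => phaseBasis n (s i)) = 0 := by
  classical
  have hinj : Function.Injective fun i => Sum.elim id id (s i) := by
    intro i j hij
    have hne : ∀ i j b, s i = Sum.inl b → s j ≠ Sum.inr b := fun i j b h1 h2 => by
      have : b ∈ pairedIndices s := mem_pairedIndices.2 ⟨⟨i, h1⟩, ⟨j, h2⟩⟩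
      simp [hp] at this
    apply hs
    rcases h1 : s i with a | a <;> rcases h2 : s j with b | b <;> simp only [h1, h2] at hij <;>
      simp only [Sum.elim_inl, Sum.elim_inr, id] at hij <;> subst hij
    · rfl
    · exact absurd h2 (hne i j _ h1)
    · exact absurd h1 (hne j i _ h2)
    · rfl
  let π : Equiv.Perm (Fin n) := Equiv.ofBijective _ (Finite.injective_iff_bijective.1 hinj)
  let B : Finset (Fin n) := Finset.univ.filter fun b => (s (π.symm b)).isRight = true
  let t : Fin n → Fin n ⊕ Fin n := fun b => if b ∈ B then Sum.inr b else Sum.inl b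
  have hst : ∀ i, s i = t (π i) := fun i => by
    have hπ : π i = Sum.elim id id (s i) := rfl
    rcases h : s i with a | a
    · have : a = π i := by rw [hπ, h]; rfl
      subst this
      simp [t, B, h]
    · have : a = π i := by rw [hπ, h]; rfl
      subst this
      simp [t, B, h]
  have ht : τ (fun i => phaseBasis n (t i)) = 0 := by
    by_cases hB : B.card = k
    · rw [← pullback_diagonal hτ hB, h0]
      rfl
    · refine map_phaseBasis_eq_zero hτ t ?_
      have : (Finset.univ.filter fun i => (t i).isRight = true) = B := by
        ext i
        by_cases hi : i ∈ B <;> simp [t, hi]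
      rwa [this]
  have : (fun i => phaseBasis n (s i)) = (fun i => phaseBasis n (t i)) ∘ π := by
    funext i
    simp [hst]
  rw [this, AlternatingMap.map_perm, ht, smul_zero]

/-- The transvection of `ℂⁿ` which maps the standard basis vector `e_b` to `e_b - e_a`. -/
noncomputable def shear {n : ℕ} (a b : Fin n) (hab : a ≠ b) : GL (Fin n) ℂ where
  val := Matrix.transvection a b (-1)
  inv := Matrix.transvection a b 1
  val_inv := by rw [Matrix.transvection_mul_transvection_same _ _ hab]; simp
  inv_val := by rw [Matrix.transvection_mul_transvection_same _ _ hab]; simp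

theorem sharp_shear_inl {n : ℕ} {a b : Fin n} (hab : a ≠ b) (c : Fin n) :
    sharp (shear a b hab) (phaseBasis n (Sum.inl c)) = phaseBasis n (Sum.inl c) +
      if c = b then phaseBasis n (Sum.inl a) else 0 := by
  have : ((shear a b hab)⁻¹ : GL (Fin n) ℂ).1 = Matrix.transvection a b 1 := rfl
  rw [phaseBasis_inl, phaseBasis_inl, sharp, this]
  refine Prod.ext ?_ ?_
  · ext i
    by_cases hc : c = b
    · subst hc
      simp [Matrix.transvection, Matrix.single, Pi.single_apply, eq_comm]
    · simp [Matrix.transvection, Matrix.single, hc, Ne.symm hc]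
  · by_cases hc : c = b <;> simp [hc]

theorem sharp_shear_inr {n : ℕ} {a b : Fin n} (hab : a ≠ b) (c : Fin n) :
    sharp (shear a b hab) (phaseBasis n (Sum.inr c)) = phaseBasis n (Sum.inr c) -
      if c = a then phaseBasis n (Sum.inr b) else 0 := by
  have : (shear a b hab).1 = Matrix.transvection a b (-1) := rfl
  rw [phaseBasis_inr, phaseBasis_inr, sharp, this]
  refine Prod.ext ?_ ?_
  · by_cases hc : c = a <;> simp [hc]
  · ext j
    by_cases hc : c = a
    · subst hc
      simp [Matrix.transvection, Matrix.single, Pi.single_apply, sub_eq_add_neg]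
      split_ifs <;> simp
    · simp [Matrix.transvection, Matrix.single, hc, Ne.symm hc]

theorem formRep_mem_primitive {n k : ℕ} (g : GL (Fin n) ℂ) {τ : Form n} (hτ : τ ∈ primitive n k) :
    formRep n g τ ∈ primitive n k :=
  (primitiveSubrep n k).apply_mem_toSubmodule g hτ

theorem pullback_formRep_eq_zero {n : ℕ} (g : GL (Fin n) ℂ) {τ : Form n}
    (hτ : pullback n τ = 0) : pullback n (formRep n g τ) = 0 := by
  funext Q
  rw [pullback_formRep, hτ]
  simp

/-- Replacing a pair of dual basis vectors in a tuple by another one. -/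
theorem map_update_pair {n k : ℕ} {s : Fin n → Fin n ⊕ Fin n} (hs : Function.Injective s)
    (ih : ∀ (τ : Form n) (t : Fin n → Fin n ⊕ Fin n), τ ∈ primitive n k → pullback n τ = 0 →
      (pairedIndices t).card < (pairedIndices s).card → τ (fun i => phaseBasis n (t i)) = 0)
    {τ : Form n} (hτ : τ ∈ primitive n k) (h0 : pullback n τ = 0) {p q a b : Fin n}
    (hp : s p = Sum.inl a) (hq : s q = Sum.inr a) (hb1 : ∀ i, s i ≠ Sum.inl b)
    (hb2 : ∀ i, s i ≠ Sum.inr b) :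
    τ (fun i => phaseBasis n (Function.update (Function.update s p (Sum.inl b)) q (Sum.inr b) i)) =
      τ (fun i => phaseBasis n (s i)) := by
  have hab : a ≠ b := fun e => hb1 p (e ▸ hp)
  have hpq : p ≠ q := fun e => by simp [e, hq] at hp
  have hl : ∀ i, s i = Sum.inl a → i = p := fun i hi => hs (hi.trans hp.symm)
  have hr : ∀ i, s i = Sum.inr a → i = q := fun i hi => hs (hi.trans hq.symm)
  have ha : a ∈ pairedIndices s := mem_pairedIndices.2 ⟨⟨p, hp⟩, ⟨q, hq⟩⟩
  have c1 : (pairedIndices (Function.update s p (Sum.inl b))).card < (pairedIndices s).card := by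
    refine Finset.card_lt_card ((Finset.ssubset_iff_of_subset fun c hc => ?_).2 ⟨a, ha, fun h => ?_⟩)
    · obtain ⟨⟨i, hi⟩, ⟨j, hj⟩⟩ := mem_pairedIndices.1 hc
      have hj' : s j = Sum.inr c := by
        by_cases e : j = p
        · subst e; simp at hj
        · rwa [Function.update_of_ne e] at hj
      by_cases e : i = p
      · subst e
        have : b = c := by simpa using hi
        exact absurd (this ▸ hj') (hb2 j)
      · rw [Function.update_of_ne e] at hi
        exact mem_pairedIndices.2 ⟨⟨i, hi⟩, ⟨j, hj'⟩⟩
    · obtain ⟨⟨i, hi⟩, -⟩ := mem_pairedIndices.1 h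
      by_cases e : i = p
      · subst e
        exact hab (by simpa using hi.symm)
      · rw [Function.update_of_ne e] at hi
        exact e (hl i hi)
  have c2 : (pairedIndices (Function.update s q (Sum.inr b))).card < (pairedIndices s).card := by
    refine Finset.card_lt_card ((Finset.ssubset_iff_of_subset fun c hc => ?_).2 ⟨a, ha, fun h => ?_⟩)
    · obtain ⟨⟨i, hi⟩, ⟨j, hj⟩⟩ := mem_pairedIndices.1 hc
      have hi' : s i = Sum.inl c := by
        by_cases e : i = q
        · subst e; simp at hi
        · rwa [Function.update_of_ne e] at hi
      by_cases e : j = q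
      · subst e
        have : b = c := by simpa using hj
        exact absurd (this ▸ hi') (hb1 i)
      · rw [Function.update_of_ne e] at hj
        exact mem_pairedIndices.2 ⟨⟨i, hi'⟩, ⟨j, hj⟩⟩
    · obtain ⟨-, ⟨i, hi⟩⟩ := mem_pairedIndices.1 h
      by_cases e : i = q
      · subst e
        exact hab (by simpa using hi.symm)
      · rw [Function.update_of_ne e] at hi
        exact e (hr i hi)
  -- The sheared form is again primitive with zero pull-back, so induction applies to it as well.
  -- Expanding its coefficient at `(e_b, wₐ)` in slots `(p, q)` gives those of `τ` at `(e_b + eₐ, wₐ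
  -- - w_b)`; the two mixed terms vanish by induction and the two pair terms must agree.
  have z1 := ih (formRep n (shear a b hab) τ) _ (formRep_mem_primitive _ hτ)
    (pullback_formRep_eq_zero _ h0) c1
  have z2 := ih τ _ hτ h0 c1
  have z3 := ih τ _ hτ h0 c2
  have hv : (fun i => sharp (shear a b hab)
      (phaseBasis n (Function.update s p (Sum.inl b) i))) =
      Function.update (Function.update (fun i => phaseBasis n (s i)) p
        (phaseBasis n (Sum.inl b) + phaseBasis n (Sum.inl a))) q
        (phaseBasis n (Sum.inr a) - phaseBasis n (Sum.inr b)) := by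
    funext i
    by_cases e : i = q
    · subst e
      rw [Function.update_of_ne hpq.symm, hq, sharp_shear_inr]
      simp
    · rw [Function.update_of_ne e]
      by_cases e2 : i = p
      · subst e2
        rw [Function.update_self, Function.update_self, sharp_shear_inl]
        simp
      · rw [Function.update_of_ne e2, Function.update_of_ne e2]
        rcases h : s i with c | c
        · rw [sharp_shear_inl, if_neg (fun e3 => hb1 i (by rw [h, e3])), add_zero]
        · rw [sharp_shear_inr, if_neg (fun e3 => e (hr i (by rw [h, e3]))), sub_zero]
  have hu : ∀ x y, τ (Function.update (Function.update (fun i => phaseBasis n (s i)) p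
      (phaseBasis n x)) q (phaseBasis n y)) =
      τ (fun i => phaseBasis n (Function.update (Function.update s p x) q y i)) := fun x y => by
    congr 1
    funext i
    by_cases e : i = q
    · subst e; simp
    · by_cases e2 : i = p
      · subst e2; simp [e]
      · simp [e, e2]
  rw [formRep_apply, AlternatingMap.compLinearMap_apply, hv, AlternatingMap.map_update_sub,
    Function.update_comm hpq, Function.update_comm hpq, AlternatingMap.map_update_add,
    AlternatingMap.map_update_add, Function.update_comm hpq.symm, Function.update_comm hpq.symm,
    Function.update_comm hpq.symm, Function.update_comm hpq.symm, hu, hu, hu, hu] at z1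
  have u1 : Function.update (Function.update s p (Sum.inl b)) q (Sum.inr a) =
      Function.update s p (Sum.inl b) := by
    rw [Function.update_eq_self_iff, Function.update_of_ne hpq.symm, hq]
  have u2 : Function.update (Function.update s p (Sum.inl a)) q (Sum.inr b) =
      Function.update s q (Sum.inr b) := by
    rw [← hp, Function.update_eq_self]
  have u3 : Function.update (Function.update s p (Sum.inl a)) q (Sum.inr a) = s := by
    rw [← hp, Function.update_eq_self, ← hq, Function.update_eq_self]
  rw [u1, u2, u3, z2, z3] at z1
  linear_combination -z1

theorem symplecticForm_phaseBasis {n : ℕ} (c : Fin n) (v : Fin 2 → Fin n ⊕ Fin n)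
    (h0 : v 0 = Sum.inl c) (h1 : v 1 = Sum.inr c) :
    symplecticForm n (fun i => phaseBasis n (v i)) = 1 := by
  rw [symplecticForm_apply, h0, h1, phaseBasis_inl, phaseBasis_inr]
  simp

theorem exists_of_symplecticForm_ne_zero {n : ℕ} (v : Fin 2 → Fin n ⊕ Fin n)
    (h : symplecticForm n (fun i => phaseBasis n (v i)) ≠ 0) :
    ∃ c, (v 0 = Sum.inl c ∧ v 1 = Sum.inr c) ∨ (v 0 = Sum.inr c ∧ v 1 = Sum.inl c) := by
  rw [symplecticForm_apply] at h
  rcases h0 : v 0 with a | a <;> rcases h1 : v 1 with b | b <;>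
    simp only [h0, h1, phaseBasis_inl, phaseBasis_inr] at h
  · simp at h
  · refine ⟨a, Or.inl ⟨rfl, ?_⟩⟩
    by_contra hne
    have : b ≠ a := fun e => hne (by rw [e])
    simp [this] at h
  · refine ⟨a, Or.inr ⟨rfl, ?_⟩⟩
    by_contra hne
    have : a ≠ b := fun e => hne (by rw [e])
    simp [this] at h
  · simp at h

theorem map_phaseBasis_eq_zero_of_pullback_eq_zero {n k : ℕ} (m : ℕ) : ∀ (τ : Form n)
    (s : Fin n → Fin n ⊕ Fin n), τ ∈ primitive n k → pullback n τ = 0 →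
    (pairedIndices s).card = m → τ (fun i => phaseBasis n (s i)) = 0 := by
  induction m using Nat.strong_induction_on with
  | _ m ih =>
  intro τ s hτ h0 hm
  by_cases hs : Function.Injective s
  swap
  · obtain ⟨i, j, hij, hne⟩ : ∃ i j, s i = s j ∧ i ≠ j := by
      simpa [Function.Injective] using hs
    exact τ.map_eq_zero_of_eq _ (by rw [hij]) hne
  by_cases hp : pairedIndices s = ∅
  · exact map_eq_zero_of_pairedIndices_eq_empty hτ.1 h0 hs hp
  have ih' : ∀ (τ : Form n) (t : Fin n → Fin n ⊕ Fin n), τ ∈ primitive n k → pullback n τ = 0 →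
      (pairedIndices t).card < (pairedIndices s).card → τ (fun i => phaseBasis n (t i)) = 0 :=
    fun τ t hτ h0 ht => ih _ (hm ▸ ht) τ t hτ h0 rfl
  -- Two slots share the index of a pair, so `n` slots cannot cover all `n` indices.
  obtain ⟨b, hb⟩ : ∃ b, ∀ i, Sum.elim id id (s i) ≠ b := by
    obtain ⟨a, ha⟩ := Finset.nonempty_iff_ne_empty.2 hp
    obtain ⟨⟨p, hp⟩, ⟨q, hq⟩⟩ := mem_pairedIndices.1 ha
    have : ¬ Function.Surjective fun i => Sum.elim id id (s i) := fun h => by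
      have := (Finite.injective_iff_surjective.2 h) (a₁ := p) (a₂ := q) (by simp [hp, hq])
      subst this
      simp [hp] at hq
    simpa [Function.Surjective] using this
  have hb1 : ∀ i, s i ≠ Sum.inl b := fun i hi => hb i (by simp [hi])
  have hb2 : ∀ i, s i ≠ Sum.inr b := fun i hi => hb i (by simp [hi])
  let v : Fin 2 ⊕ Fin n → Fin n ⊕ Fin n := Sum.elim ![Sum.inl b, Sum.inr b] s
  have hv : Function.Injective v := by
    refine Function.Injective.sumElim ?_ hs ?_
    · intro i j hij
      fin_cases i <;> fin_cases j <;> simp_all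
    · intro i j
      fin_cases i
      · exact (hb1 j).symm
      · exact (hb2 j).symm
  -- Each pair of `v` can be brought to the two slots of `ω` by an even permutation that leaves the
  -- coefficient of `τ` unchanged: the identity for the pair `b`, and otherwise two swaps, whose
  -- effect on `s` is the replacement in `map_update_pair`.
  have key : ∀ c x y, v x = Sum.inl c → v y = Sum.inr c →
      ∃ κ : Equiv.Perm (Fin 2 ⊕ Fin n), Equiv.Perm.sign κ = 1 ∧ κ (Sum.inl 0) = x ∧
        κ (Sum.inl 1) = y ∧
        τ (fun i => phaseBasis n (v (κ (Sum.inr i)))) = τ (fun i => phaseBasis n (s i)) := by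
    intro c x y hx hy
    by_cases hc : c = b
    · subst hc
      refine ⟨1, Equiv.Perm.sign_one, hv ?_, hv ?_, rfl⟩
      · rw [hx]; rfl
      · rw [hy]; rfl
    · obtain ⟨p, rfl⟩ : ∃ p, x = Sum.inr p := by
        rcases x with x | x
        · exfalso
          fin_cases x
          · exact hc (by simpa [v] using hx.symm)
          · simp [v] at hx
        · exact ⟨x, rfl⟩
      obtain ⟨q, rfl⟩ : ∃ q, y = Sum.inr q := by
        rcases y with y | y
        · exfalso
          fin_cases y
          · simp [v] at hy
          · exact hc (by simpa [v] using hy.symm)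
        · exact ⟨y, rfl⟩
      have hpq : p ≠ q := fun e => by
        rw [e, hy] at hx
        simp at hx
      refine ⟨Equiv.swap (Sum.inl 0) (Sum.inr p) * Equiv.swap (Sum.inl 1) (Sum.inr q), ?_, ?_, ?_,
        ?_⟩
      · rw [Equiv.Perm.sign_mul, Equiv.Perm.sign_swap (by simp), Equiv.Perm.sign_swap (by simp)]
        simp
      · rw [Equiv.Perm.mul_apply,
          Equiv.swap_apply_of_ne_of_ne (a := Sum.inl 1) (by simp) (by simp),
          Equiv.swap_apply_left]
      · rw [Equiv.Perm.mul_apply, Equiv.swap_apply_left,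
          Equiv.swap_apply_of_ne_of_ne (by simp) (by simpa using hpq.symm)]
      · rw [← map_update_pair hs ih' hτ h0 hx hy hb1 hb2]
        congr 1
        funext i
        congr 1
        by_cases e : i = q
        · subst e
          rw [Equiv.Perm.mul_apply, Equiv.swap_apply_right,
            Equiv.swap_apply_of_ne_of_ne (by simp) (by simp), Function.update_self]
          rfl
        · rw [Function.update_of_ne e, Equiv.Perm.mul_apply,
            Equiv.swap_apply_of_ne_of_ne (a := Sum.inl 1) (by simp) (by simpa using e)]
          by_cases e2 : i = p
          · subst e2
            rw [Equiv.swap_apply_right, Function.update_self]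
            rfl
          · rw [Equiv.swap_apply_of_ne_of_ne (by simp) (by simpa using e2),
              Function.update_of_ne e2]
            rfl
  have hterm : ∀ σ : Equiv.Perm (Fin 2 ⊕ Fin n),
      symplecticForm n (fun i => phaseBasis n (v (σ (Sum.inl i)))) ≠ 0 →
      ((Equiv.Perm.sign σ : ℤ) : ℂ) *
        (symplecticForm n (fun i => phaseBasis n (v (σ (Sum.inl i)))) *
          τ fun i => phaseBasis n (v (σ (Sum.inr i)))) = τ (fun i => phaseBasis n (s i)) := by
    intro σ hσ
    obtain ⟨c, hc⟩ := exists_of_symplecticForm_ne_zero (fun i => v (σ (Sum.inl i))) hσ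
    obtain ⟨κ, hκ, hκc, hκm, hκτ⟩ : ∃ κ : Equiv.Perm (Fin 2 ⊕ Fin n), Equiv.Perm.sign κ = 1 ∧
        (v (κ (Sum.inl 0)) = Sum.inl c ∧ v (κ (Sum.inl 1)) = Sum.inr c) ∧
        (∀ i, ∃ j, σ (Sum.inl i) = κ (Sum.inl j)) ∧
        τ (fun i => phaseBasis n (v (κ (Sum.inr i)))) = τ (fun i => phaseBasis n (s i)) := by
      rcases hc with ⟨hc0, hc1⟩ | ⟨hc0, hc1⟩
      · obtain ⟨κ, h1, h2, h3, h4⟩ := key c _ _ hc0 hc1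
        refine ⟨κ, h1, ⟨h2 ▸ hc0, h3 ▸ hc1⟩, fun i => ?_, h4⟩
        fin_cases i
        · exact ⟨0, h2.symm⟩
        · exact ⟨1, h3.symm⟩
      · obtain ⟨κ, h1, h2, h3, h4⟩ := key c _ _ hc1 hc0
        refine ⟨κ, h1, ⟨h2 ▸ hc1, h3 ▸ hc0⟩, fun i => ?_, h4⟩
        fin_cases i
        · exact ⟨1, h3.symm⟩
        · exact ⟨0, h2.symm⟩
    -- Both permutations put the same pair into the slots of `ω`, so they differ by a block
    -- permutation. Its signs occur once in `sign σ` and once in the factors, and cancel.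
    obtain ⟨⟨ρ₁, ρ₂⟩, hρ⟩ := Equiv.Perm.mem_sumCongrHom_range_of_perm_mapsTo_inl
      (σ := κ⁻¹ * σ) (by
        rintro _ ⟨i, rfl⟩
        obtain ⟨j, hj⟩ := hκm i
        exact ⟨j, by rw [Equiv.Perm.mul_apply, hj]; simp⟩)
    have hσκ : σ = κ * Equiv.Perm.sumCongr ρ₁ ρ₂ := by
      rw [eq_comm, ← eq_inv_mul_iff_mul_eq]
      exact hρ
    have e1 : symplecticForm n (fun i => phaseBasis n (v (σ (Sum.inl i)))) =
        ((Equiv.Perm.sign ρ₁ : ℤ) : ℂ) := by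
      have := (symplecticForm n).map_perm (fun i => phaseBasis n (v (κ (Sum.inl i)))) ρ₁
      rw [symplecticForm_phaseBasis c (fun i => v (κ (Sum.inl i))) hκc.1 hκc.2, Units.smul_def,
        zsmul_eq_mul, mul_one] at this
      rw [← this, hσκ]
      rfl
    have e2 : τ (fun i => phaseBasis n (v (σ (Sum.inr i)))) =
        ((Equiv.Perm.sign ρ₂ : ℤ) : ℂ) * τ (fun i => phaseBasis n (s i)) := by
      have := τ.map_perm (fun i => phaseBasis n (v (κ (Sum.inr i)))) ρ₂
      rw [hκτ, Units.smul_def, zsmul_eq_mul] at this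
      rw [← this, hσκ]
      rfl
    have e3 : ∀ {m : ℕ} (ρ : Equiv.Perm (Fin m)),
        ((Equiv.Perm.sign ρ : ℤ) : ℂ) * ((Equiv.Perm.sign ρ : ℤ) : ℂ) = 1 := fun ρ => by
      norm_cast
      simp
    have e4 : ((Equiv.Perm.sign σ : ℤ) : ℂ) =
        ((Equiv.Perm.sign ρ₁ : ℤ) : ℂ) * ((Equiv.Perm.sign ρ₂ : ℤ) : ℂ) := by
      rw [hσκ, Equiv.Perm.sign_mul, hκ, one_mul, Equiv.Perm.sign_sumCongr]
      push_cast
      rfl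
    rw [e1, e2, e4]
    linear_combination (τ (fun i => phaseBasis n (s i))) * (((Equiv.Perm.sign ρ₂ : ℤ) : ℂ) ^ 2 *
      e3 ρ₁ + e3 ρ₂)
  have hsum := (wedge_symplecticForm_eq_zero_iff τ).1 hτ.2 v hv
  have hif : ∀ σ : Equiv.Perm (Fin 2 ⊕ Fin n), ((Equiv.Perm.sign σ : ℤ) : ℂ) *
        (symplecticForm n (fun i => phaseBasis n (v (σ (Sum.inl i)))) *
          τ fun i => phaseBasis n (v (σ (Sum.inr i)))) =
      if symplecticForm n (fun i => phaseBasis n (v (σ (Sum.inl i)))) ≠ 0 then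
        τ (fun i => phaseBasis n (s i)) else 0 := fun σ => by
    split_ifs with h
    · exact hterm σ h
    · rw [not_not.1 h, zero_mul, mul_zero]
  simp only [hif] at hsum
  -- All nonvanishing `ω` terms are equal, so the sum is their number times the coefficient; the
  -- identity permutation shows that this number is positive.
  rw [← Finset.sum_filter, Finset.sum_const, nsmul_eq_mul] at hsum
  refine (mul_eq_zero.1 hsum).resolve_left (Nat.cast_ne_zero.2 (Finset.card_ne_zero_of_mem
    (a := 1) ?_))
  rw [Finset.mem_filter]
  refine ⟨Finset.mem_univ _, ?_⟩
  rw [symplecticForm_phaseBasis b (fun i => v ((1 : Equiv.Perm (Fin 2 ⊕ Fin n)) (Sum.inl i)))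
    rfl rfl]
  exact one_ne_zero

/-- A primitive form is determined by its pull-backs to the graphs of symmetric matrices. -/
theorem eq_zero_of_pullback_eq_zero {n k : ℕ} {τ : Form n} (hτ : τ ∈ primitive n k)
    (h0 : pullback n τ = 0) : τ = 0 :=
  Module.Basis.ext_alternating (phaseBasis n) fun s _ =>
    map_phaseBasis_eq_zero_of_pullback_eq_zero _ τ s hτ h0 rfl


/-! ### Surjectivity onto the minors -/

/-- Cauchy-Binet is applied to each of the two products in `gᵀ Q g`; summing over all index tuples
instead of increasing ones accounts for a factor `k!` each time. -/
theorem minor_congruence {n k : ℕ} (hk : k ≤ n) (g : Matrix (Fin n) (Fin n) ℂ) (Q : SM n) :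
    ((k.factorial : ℂ) * k.factorial) *
      minor (Fin.castLE hk) (Fin.castLE hk) (congruence g Q) =
      ∑ I, ∑ J, ((g.submatrix I (Fin.castLE hk)).det * (g.submatrix J (Fin.castLE hk)).det) *
        minor I J Q := by
  have e : (congruence g Q).1.submatrix (Fin.castLE hk) (Fin.castLE hk) =
      (g.submatrix id (Fin.castLE hk))ᵀ * (Q.1 * g.submatrix id (Fin.castLE hk)) := by
    change (gᵀ * Q.1 * g).submatrix _ _ = _
    rw [Matrix.mul_assoc]
    rfl
  rw [minor, e, mul_assoc, factorial_mul_det_mul, Finset.mul_sum]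
  refine Finset.sum_congr rfl fun I _ => ?_
  have e2 : (Q.1 * g.submatrix id (Fin.castLE hk)).submatrix I id =
      Q.1.submatrix I id * g.submatrix id (Fin.castLE hk) := rfl
  rw [e2, mul_left_comm, factorial_mul_det_mul, Finset.mul_sum]
  refine Finset.sum_congr rfl fun J _ => ?_
  have e3 : ((g.submatrix id (Fin.castLE hk))ᵀ.submatrix id I).det =
      (g.submatrix I (Fin.castLE hk)).det := by
    rw [← Matrix.det_transpose]
    rfl
  rw [e3]
  simp only [Matrix.submatrix_submatrix, Function.comp_id, Function.id_comp, minor]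
  ring

/-- The pull-backs of the translates of `coordForm` span all minors. -/
theorem minorSpan_le_map_pullback {n k : ℕ} (hk : k ≤ n) (W : Submodule ℂ (Form n))
    (hW : ∀ g, formRep n g (coordForm n k) ∈ W) : minorSpan n k ≤ W.map (pullback n) := by
  intro f hf
  by_contra hfW
  obtain ⟨φ, hφf, hφ⟩ := Submodule.exists_le_ker_of_notMem hfW
  let c : (Fin k → Fin n) → (Fin k → Fin n) → ℂ := fun I J => φ (minor I J)
  have hc : ∀ g : GL (Fin n) ℂ, ∑ I, ∑ J, c I J *
      ((g.1.submatrix I (Fin.castLE hk)).det * (g.1.submatrix J (Fin.castLE hk)).det) = 0 := by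
    intro g
    have h1 : φ (pullback n (formRep n g (coordForm n k))) = 0 :=
      hφ (Submodule.mem_map_of_mem (hW g))
    have h2 : (g.1.det * ((k.factorial : ℂ) * k.factorial)) •
        pullback n (formRep n g (coordForm n k)) =
        ∑ I, ∑ J, ((g.1.submatrix I (Fin.castLE hk)).det *
          (g.1.submatrix J (Fin.castLE hk)).det) • minor I J := by
      funext Q
      have hd : g.1.det * (g⁻¹).1.det = 1 := by
        rw [← Matrix.det_mul, ← Units.val_mul, mul_inv_cancel, Units.val_one, Matrix.det_one]
      have h3 := minor_congruence hk g.1 Q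
      simp only [Pi.smul_apply, Finset.sum_apply, smul_eq_mul]
      rw [← h3, pullback_formRep, pullback_coordForm hk]
      linear_combination ((k.factorial : ℂ) * k.factorial) *
        minor (Fin.castLE hk) (Fin.castLE hk) (congruence g.1 Q) * hd
    have h4 := congrArg φ h2
    rw [map_smul, h1, smul_zero] at h4
    simp only [map_sum, map_smul, smul_eq_mul] at h4
    rw [h4]
    exact Finset.sum_congr rfl fun I _ => Finset.sum_congr rfl fun J _ => mul_comm _ _
  -- The group is stable under entrywise conjugation, so the conjugated coefficients satisfy the
  -- same relation. Passing to minors and applying `φ` then yields `∑ |c I J|² = 0`.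
  have hconj : ∀ g : GL (Fin n) ℂ, ∑ I, ∑ J, starRingEnd ℂ (c I J) *
      ((g.1.submatrix I (Fin.castLE hk)).det * (g.1.submatrix J (Fin.castLE hk)).det) = 0 := by
    intro g
    have h := congrArg (starRingEnd ℂ) (hc (Matrix.GeneralLinearGroup.map (starRingEnd ℂ) g))
    have hd : ∀ I : Fin k → Fin n, starRingEnd ℂ
        ((Matrix.GeneralLinearGroup.map (starRingEnd ℂ) g).1.submatrix I (Fin.castLE hk)).det =
        (g.1.submatrix I (Fin.castLE hk)).det := fun I => by
      rw [RingHom.map_det]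
      congr 1
      ext a b
      simp
    simpa only [map_sum, map_mul, map_zero, hd] using h
  have hz : ∑ I, ∑ J, starRingEnd ℂ (c I J) • minor (n := n) I J = 0 := by
    funext Q
    simpa using sum_minor_eq_zero hk _ hconj Q
  have hz2 := congrArg φ hz
  simp only [map_sum, map_smul, smul_eq_mul, map_zero] at hz2
  have hnorm : ∑ I : Fin k → Fin n, ∑ J : Fin k → Fin n, Complex.normSq (c I J) = 0 := by
    have : ((∑ I : Fin k → Fin n, ∑ J : Fin k → Fin n, Complex.normSq (c I J) : ℝ) : ℂ) = 0 := by
      push_cast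
      rw [← hz2]
      exact Finset.sum_congr rfl fun I _ => Finset.sum_congr rfl fun J _ =>
        Complex.normSq_eq_conj_mul_self
    exact_mod_cast this
  have hc0 : ∀ I J, c I J = 0 := fun I J => by
    have h1 := (Finset.sum_eq_zero_iff_of_nonneg fun I _ => Finset.sum_nonneg fun J _ =>
      Complex.normSq_nonneg _).1 hnorm I (Finset.mem_univ _)
    have h2 := (Finset.sum_eq_zero_iff_of_nonneg fun J _ =>
      Complex.normSq_nonneg _).1 h1 J (Finset.mem_univ _)
    exact Complex.normSq_eq_zero.1 h2
  obtain ⟨ψ, hψ⟩ := exists_sum_minor_of_mem_minorSpan hf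
  have hfψ : f = ∑ I, ∑ J, ψ I J • minor I J := by
    funext Q
    simp [hψ]
  apply hφf
  rw [hfψ]
  simp only [map_sum, map_smul]
  exact Finset.sum_eq_zero fun I _ => Finset.sum_eq_zero fun J _ => by
    rw [show φ (minor I J) = 0 from hc0 I J, smul_zero]

/-! ### Irreducibility -/

/-- The set of the first `k` indices. -/
def firstIndices (n k : ℕ) : Finset (Fin n) := Finset.univ.filter fun i => i.1 < k

theorem card_firstIndices {n k : ℕ} (hk : k ≤ n) : (firstIndices n k).card = k := by
  rw [firstIndices, Fin.card_filter_val_lt]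
  exact min_eq_right hk

/-- An element of `minorSpan` which vanishes on the symmetric matrices of rank `k` is zero. -/
theorem eq_zero_of_congruence_eq_zero {n k : ℕ} (hk : k ≤ n) {f : SM n → ℂ}
    (hf : f ∈ minorSpan n k)
    (h : ∀ g : GL (Fin n) ℂ, f (congruence g.1 (diagonalOn (firstIndices n k))) = 0) : f = 0 := by
  obtain ⟨φ, hφ⟩ := exists_sum_minor_of_mem_minorSpan hf
  funext Q
  rw [hφ]
  refine sum_minor_eq_zero hk φ (fun g => ?_) Q
  have hd : g.1ᵀ.det ≠ 0 := by
    rw [Matrix.det_transpose]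
    exact (Matrix.isUnits_det_units g).ne_zero
  have hg := h (Matrix.GeneralLinearGroup.mkOfDetNeZero _ hd)
  rw [hφ] at hg
  rw [← hg]
  refine Finset.sum_congr rfl fun I _ => Finset.sum_congr rfl fun J _ => ?_
  congr 1
  -- The matrix `g D gᵀ`, with `D` the projection to the first `k` coordinates, only sees the first
  -- `k` columns of `g`, so its minors factor as `det g_I det g_J`.
  have e : (congruence g.1ᵀ (diagonalOn (firstIndices n k))).1.submatrix I J =
      g.1.submatrix I (Fin.castLE hk) * (g.1.submatrix J (Fin.castLE hk))ᵀ := by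
    ext a b
    change (g.1ᵀᵀ * Matrix.diagonal (fun i => if i ∈ firstIndices n k then (1 : ℂ) else 0) * g.1ᵀ :
      Matrix (Fin n) (Fin n) ℂ) (I a) (J b) = _
    rw [Matrix.transpose_transpose, Matrix.mul_apply, Matrix.mul_apply]
    simp only [Matrix.mul_diagonal, Matrix.transpose_apply, Matrix.submatrix_apply]
    have e1 : ∀ x : Fin n, (g.1 (I a) x * if x ∈ firstIndices n k then 1 else 0) * g.1 (J b) x =
        if x ∈ firstIndices n k then g.1 (I a) x * g.1 (J b) x else 0 := fun x => by
      split_ifs <;> simp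
    have e2 : firstIndices n k = Finset.univ.map (Fin.castLEEmb hk) := by
      ext x
      simp only [firstIndices, Finset.mem_filter, Finset.mem_univ, true_and, Finset.mem_map,
        Fin.castLEEmb_apply]
      exact ⟨fun hx => ⟨⟨x.1, hx⟩, rfl⟩, by rintro ⟨y, rfl⟩; exact y.2⟩
    rw [Finset.sum_congr rfl fun x _ => e1 x, Finset.sum_ite_mem, Finset.univ_inter, e2,
      Finset.sum_map]
    rfl
  refine Eq.trans ?_ (congrArg Matrix.det e).symm
  rw [Matrix.det_mul, Matrix.det_transpose]

/-- The diagonal matrix with entries `2` at the first `k` positions and `1` at the others. -/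
noncomputable def torusElement (n k : ℕ) : GL (Fin n) ℂ where
  val := Matrix.diagonal fun i => if i.1 < k then 2 else 1
  inv := Matrix.diagonal fun i => if i.1 < k then 2⁻¹ else 1
  val_inv := by
    rw [Matrix.diagonal_mul_diagonal, ← Matrix.diagonal_one]
    congr 1
    ext i
    split_ifs <;> simp
  inv_val := by
    rw [Matrix.diagonal_mul_diagonal, ← Matrix.diagonal_one]
    congr 1
    ext i
    split_ifs <;> simp

/-- The eigenvalues of `torusElement` on the basis vectors of the phase space. -/
noncomputable def torusWeight {n : ℕ} (k : ℕ) : Fin n ⊕ Fin n → ℝ :=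
  Sum.elim (fun i => if i.1 < k then 2⁻¹ else 1) fun i => if i.1 < k then 2 else 1

theorem sharp_torusElement {n k : ℕ} (s : Fin n ⊕ Fin n) :
    sharp (torusElement n k) (phaseBasis n s) = (torusWeight k s : ℂ) • phaseBasis n s := by
  have h1 : (torusElement n k).1 = Matrix.diagonal fun i => if i.1 < k then 2 else 1 := rfl
  have h2 : ((torusElement n k)⁻¹ : GL (Fin n) ℂ).1 =
    Matrix.diagonal fun i => if i.1 < k then 2⁻¹ else 1 := rfl
  rw [sharp, h1, h2]
  rcases s with j | j
  · rw [phaseBasis_inl]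
    refine Prod.ext ?_ ?_
    · ext i
      by_cases hij : i = j
      · subst hij
        by_cases hi : i.1 < k <;> simp [torusWeight, hi]
      · simp [hij]
    · simp
  · rw [phaseBasis_inr]
    refine Prod.ext ?_ ?_
    · simp
    · ext i
      by_cases hij : i = j
      · subst hij
        by_cases hi : i.1 < k <;> simp [torusWeight, hi]
      · simp [Ne.symm hij]

theorem torusWeight_pos {n k : ℕ} (s : Fin n ⊕ Fin n) : 0 < torusWeight k s := by
  rcases s with j | j <;> by_cases hj : j.1 < k <;> simp [torusWeight, hj]

theorem torusWeight_le {n k : ℕ} (s : Fin n ⊕ Fin n) :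
    torusWeight k s ≤ if s.isRight = true then 2 else 1 := by
  rcases s with j | j <;> by_cases hj : j.1 < k <;> (simp [torusWeight, hj]; try norm_num)

theorem torusWeight_lt {n k : ℕ} {s : Fin n ⊕ Fin n} (hs : s ∉ Set.range (coordSection k)) :
    torusWeight k s < if s.isRight = true then 2 else 1 := by
  rcases s with j | j
  · have hj : j.1 < k := by
      by_contra h
      exact hs ⟨j, by simp [coordSection, h]⟩
    simp [torusWeight, hj]
    norm_num
  · have hj : ¬ j.1 < k := fun h => hs ⟨j, by simp [coordSection, h]⟩
    simp [torusWeight, hj]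

/-- With `k` covectors, the weight `2 ^ k` is the maximum and needs every slot to attain its bound;
a single vector outside `coordSection` makes the inequality strict. -/
theorem prod_torusWeight_lt {n k : ℕ} {s : Fin n → Fin n ⊕ Fin n}
    (hs : (Finset.univ.filter fun i => (s i).isRight = true).card = k) {i : Fin n}
    (hi : s i ∉ Set.range (coordSection k)) : ∏ i, torusWeight k (s i) < 2 ^ k := by
  have : (2 : ℝ) ^ k = ∏ i, if (s i).isRight = true then 2 else 1 := by
    rw [← Finset.prod_filter, Finset.prod_const, hs]
  rw [this]
  exact Finset.prod_lt_prod (fun i _ => torusWeight_pos _) (fun i _ => torusWeight_le _)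
    ⟨i, Finset.mem_univ _, torusWeight_lt hi⟩

/-- An invariant subspace which contains a form with a nonzero coefficient of highest weight
contains `coordForm`. -/
theorem coordForm_mem {n k : ℕ} (hk : k ≤ n) {W : Submodule ℂ (Form n)}
    (hW : ∀ g, ∀ τ ∈ W, formRep n g τ ∈ W) {τ : Form n} (hτW : τ ∈ W) (hτ : τ ∈ bidegree n k)
    (h : pullback n τ (diagonalOn (firstIndices n k)) ≠ 0) : coordForm n k ∈ W := by
  classical
  let wt : (Fin n → Fin n ⊕ Fin n) → ℂ := fun s => ((∏ i, torusWeight k (s i) : ℝ) : ℂ)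
  have hT : ∀ (η : Form n) (s : Fin n → Fin n ⊕ Fin n),
      formRep n (torusElement n k) η (fun i => phaseBasis n (s i)) =
        wt s * η fun i => phaseBasis n (s i) := fun η s => by
    rw [formRep_apply, AlternatingMap.compLinearMap_apply]
    simp only [sharp_torusElement]
    refine (η.toMultilinearMap.map_smul_univ _ _).trans ?_
    simp [wt]
  -- The torus element `T` acts diagonally on coefficients, so the operator `∏ (T - c)` preserves
  -- the invariant subspace and multiplies each coefficient by `∏ (wt s - c)`. Letting `c` run
  -- through all weights except `2 ^ k` kills every coefficient of another weight.
  have hprod : ∀ C : Finset ℂ, ∃ η ∈ W, ∀ s : Fin n → Fin n ⊕ Fin n,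
      η (fun i => phaseBasis n (s i)) = (∏ c ∈ C, (wt s - c)) * τ fun i => phaseBasis n (s i) := by
    intro C
    induction C using Finset.induction_on with
    | empty => exact ⟨τ, hτW, fun s => by simp⟩
    | insert c C hc ih =>
      obtain ⟨η, hη, hηs⟩ := ih
      refine ⟨formRep n (torusElement n k) η - c • η,
        W.sub_mem (hW _ _ hη) (W.smul_mem _ hη), fun s => ?_⟩
      rw [AlternatingMap.sub_apply, AlternatingMap.smul_apply, hT, hηs, Finset.prod_insert hc,
        smul_eq_mul]
      ring
  obtain ⟨η, hη, hηs⟩ := hprod ((Finset.univ.image wt).erase (2 ^ k))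
  have hη0 : ∀ (s : Fin n → Fin n ⊕ Fin n) i, s i ∉ Set.range (coordSection k) →
      η (fun i => phaseBasis n (s i)) = 0 := by
    intro s i hi
    rw [hηs]
    by_cases hs : (Finset.univ.filter fun i => (s i).isRight = true).card = k
    · have hne : wt s ≠ 2 ^ k := by
        intro e
        refine (prod_torusWeight_lt hs hi).ne (Complex.ofReal_injective (e.trans ?_))
        push_cast
        rfl
      rw [Finset.prod_eq_zero (i := wt s) _ (sub_self _), zero_mul]
      exact Finset.mem_erase.2 ⟨hne, Finset.mem_image_of_mem _ (Finset.mem_univ _)⟩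
    · rw [map_phaseBasis_eq_zero hτ s hs, mul_zero]
  have hsec : ∀ i : Fin n, (if i ∈ firstIndices n k then Sum.inr i else Sum.inl i) =
      coordSection k i := fun i => by
    simp [firstIndices, coordSection]
  have hne : η (fun i => phaseBasis n (coordSection k i)) ≠ 0 := by
    rw [hηs]
    refine mul_ne_zero ?_ ?_
    · have hwt : wt (coordSection k) = 2 ^ k := by
        have h1 : ∀ i : Fin n, torusWeight k (coordSection k i) =
            if i ∈ firstIndices n k then 2 else 1 := fun i => by
          by_cases hi : i.1 < k <;> simp [torusWeight, coordSection, firstIndices, hi]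
        simp only [wt, h1]
        rw [Finset.prod_ite_mem, Finset.univ_inter, Finset.prod_const, card_firstIndices hk]
        push_cast
        rfl
      rw [Finset.prod_ne_zero_iff]
      intro c hc
      rw [hwt, sub_ne_zero]
      exact (Finset.ne_of_mem_erase hc).symm
    · rw [pullback_diagonal hτ (card_firstIndices hk)] at h
      simpa only [hsec] using h
  have hηc : η = η (fun i => phaseBasis n (coordSection k i)) • coordForm n k := by
    refine Module.Basis.ext_alternating (phaseBasis n) fun s hs => ?_
    by_cases hr : ∀ i, s i ∈ Set.range (coordSection k)
    · obtain ⟨ρ, hρ⟩ := exists_perm_of_mem_range hs hr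
      have e : (fun i => phaseBasis n (s i)) =
          (fun i => phaseBasis n (coordSection k i)) ∘ ρ := by
        funext i
        simp [hρ]
      rw [e, AlternatingMap.map_perm, AlternatingMap.smul_apply, AlternatingMap.map_perm,
        coordForm_coordSection, smul_comm, smul_eq_mul, mul_one]
    · push Not at hr
      obtain ⟨i, hi⟩ := hr
      rw [hη0 s i hi, AlternatingMap.smul_apply, coordForm_eq_zero hi, smul_zero]
  rw [hηc] at hη
  exact (Submodule.smul_mem_iff _ hne).1 hη

theorem primitiveRep_isIrreducible {n k : ℕ} (hk : k ≤ n) : (primitiveRep n k).IsIrreducible := by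
  have hv0 := coordForm_mem_primitive hk
  have hv0ne : coordForm n k ≠ 0 := fun h => by
    have := coordForm_coordSection n k
    rw [h] at this
    simp at this
  have hnt : Nontrivial (Subrepresentation (primitiveRep n k)) := by
    refine ⟨⊥, ⊤, fun h => hv0ne ?_⟩
    have h1 : (⟨coordForm n k, hv0⟩ : primitive n k) ∈
        (⊤ : Subrepresentation (primitiveRep n k)).toSubmodule := Submodule.mem_top
    rw [← h] at h1
    exact congrArg Subtype.val ((Submodule.mem_bot ℂ).1 h1)
  refine { eq_bot_or_eq_top := fun W => ?_ }
  by_cases hW : W.toSubmodule = ⊥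
  · exact Or.inl (Subrepresentation.toSubmodule_injective hW)
  refine Or.inr (Subrepresentation.toSubmodule_injective ?_)
  let W' : Submodule ℂ (Form n) := W.toSubmodule.map (primitive n k).subtype
  have hW' : ∀ g, ∀ τ ∈ W', formRep n g τ ∈ W' := by
    rintro g _ ⟨τ, hτ, rfl⟩
    exact ⟨primitiveRep n k g τ, W.apply_mem_toSubmodule g hτ, rfl⟩
  obtain ⟨w, hw, hw0⟩ := (Submodule.ne_bot_iff _).1 hW
  have hpw : pullback n w.1 ≠ 0 := fun h =>
    hw0 (Subtype.ext (eq_zero_of_pullback_eq_zero w.2 h))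
  -- A nonzero element of the span of minors cannot vanish on the whole orbit of
  -- `diag(1,…,1,0,…,0)`, so some translate of `w` has a nonzero extremal coefficient.
  obtain ⟨g, hg⟩ : ∃ g : GL (Fin n) ℂ,
      pullback n w.1 (congruence g.1 (diagonalOn (firstIndices n k))) ≠ 0 := by
    by_contra! h
    exact hpw (eq_zero_of_congruence_eq_zero hk (pullback_mem_minorSpan w.2.1) h)
  have hmem : coordForm n k ∈ W' := by
    refine coordForm_mem hk hW' (hW' g _ ⟨w, hw, rfl⟩) (formRep_mem_primitive g w.2).1 ?_
    rw [pullback_formRep]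
    exact mul_ne_zero (Matrix.isUnits_det_units g⁻¹).ne_zero hg
  change W.toSubmodule = (⊤ : Submodule ℂ (primitive n k))
  rw [eq_top_iff]
  rintro τ -
  -- The subspace already realises every polynomial in the span of minors; injectivity of the
  -- pull-back then identifies `τ` with an element of it.
  obtain ⟨η, ⟨η', hη', rfl⟩, hη⟩ := minorSpan_le_map_pullback hk W' (fun g => hW' g _ hmem)
    (pullback_mem_minorSpan τ.2.1)
  have : (τ - η').1 = 0 := eq_zero_of_pullback_eq_zero (τ - η').2 (by
    rw [Submodule.coe_sub, map_sub, sub_eq_zero]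
    exact hη.symm)
  have h2 : τ = η' := sub_eq_zero.1 (Subtype.ext this)
  exact h2 ▸ hη'

end PrimitiveForms

theorem mainTheorem9 (n k : ℕ) (hk : k ≤ n) :
    (∃ P : primitive n k →ₗ[ℂ] (SM n → ℂ),
      (∀ τ : primitive n k, P τ ∈ homogeneousPolynomials k (SM n)) ∧
      (∀ (τ : primitive n k) (Q : SM n),
        τ.1.compLinearMap (graphMap Q) = P τ Q • volumeForm n) ∧
      (∀ (τ : primitive n k) (p : SM n → ℂ),
        (∀ Q : SM n, τ.1.compLinearMap (graphMap Q) = p Q • volumeForm n) → p = P τ) ∧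
      Function.Injective P ∧
      LinearMap.range P = minorSpan n k) ∧
    (primitiveRep n k).IsIrreducible := by
  refine ⟨⟨(pullback n).comp (primitive n k).subtype, fun τ => ?_, fun τ Q => ?_, fun τ p hp => ?_,
    ?_, ?_⟩, primitiveRep_isIrreducible hk⟩
  · exact minorSpan_le_homogeneousPolynomials n k (pullback_mem_minorSpan τ.2.1)
  · exact compLinearMap_graphMap τ.1 Q
  · funext Q
    have h := hp Q
    rw [compLinearMap_graphMap] at h
    have h2 := DFunLike.congr_fun h fun i => Pi.single i 1
    simp only [AlternatingMap.smul_apply, volumeForm_single, smul_eq_mul, mul_one] at h2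
    exact h2.symm
  · rw [← LinearMap.ker_eq_bot, LinearMap.ker_eq_bot']
    exact fun τ hτ => Subtype.ext (eq_zero_of_pullback_eq_zero τ.2 hτ)
  · refine le_antisymm ?_ ?_
    · rintro _ ⟨τ, rfl⟩
      exact pullback_mem_minorSpan τ.2.1
    · rw [LinearMap.range_comp, Submodule.range_subtype]
      exact minorSpan_le_map_pullback hk _ fun g =>
        formRep_mem_primitive g (coordForm_mem_primitive hk)
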